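/- Let $L$ be a finite lattice that is semimodular ($x\preceq y$ implies $x\vee z\preceq y\vee z$) and slim (the poset of join-irreducible elements of $L$ has no $3$-element antichain). Then $L$ has a planar Hasse diagram. Moreover, fix any planar Hasse diagram of $L$ (with straight line segments as edges) and let $\mathfrak p$ and $\mathfrak q$ be prime intervals of $L$, where a prime interval $\mathfrak r=[0_{\mathfrak r},1_{\mathfrak r}]$ is an interval with $0_{\mathfrak r}\prec 1_{\mathfrak r}$. Let $\operatorname{con}(\mathfrak p)$ be the least congruence of $L$ collapsing $0_{\mathfrak p}$ and $1_{\mathfrak p}$. Then $(0_{\mathfrak q},1_{\mathfrak q})\in\operatorname{con}(\mathfrak p)$ if and only if there is an SS-sequence from $\mathfrak p$ to $\mathfrak q$, that is, a sequence $\mathfrak r_0=\mathfrak p,\mathfrak r_1,\dots,\mathfrak r_n=\mathfrak q$ ($n\ge 0$) of prime intervals such that for each $i\in\{1,\dots,n\}$, $\mathfrak r_{i-1}$ is cell-perspective to $\mathfrak r_i$ or swings to $\mathfrak r_i$. Here a region consists of the elements of an interval $[a,b]$ (where $a<b$ and $a\nprec b$) that are on the right of $C_1$ and on the left of $C_2$,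 where $C_1$ and $C_2$ are maximal chains of $[a,b]$ with $C_1\cap C_2=\{a,b\}$ and $C_2\setminus\{a,b\}$ on the right of $C_1$ (elements of a chain count as being on both sides of it). A cell is a minimal region, and a $4$-cell is a cell with four vertices and four edges. For distinct prime intervals $\mathfrak r,\mathfrak s$ belonging to the same $4$-cell, $\mathfrak r$ is cell-perspective to $\mathfrak s$ if they are opposite sides of this $4$-cell, and $\mathfrak r$ swings to $\mathfrak s$ if $1_{\mathfrak r}=1_{\mathfrak s}$, the element $1_{\mathfrak r}$ has at least three lower covers, and $0_{\mathfrak s}$ is neither the leftmost nor the rightmost lower cover of $1_{\mathfrak r}$. -/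

import Mathlib

namespace SwingLemma

/-- A lattice is slim if its poset of join-irreducible elements has no 3-element antichain.
(Slim lattices are finite by convention; finiteness is a separate hypothesis.) -/
def IsSlim (L : Type*) [Lattice L] : Prop :=
  ¬ ∃ s : Finset L, s.card = 3 ∧ (∀ x ∈ s, SupIrred x) ∧ IsAntichain (· ≤ ·) (s : Set L)

/-- A prime interval (edge) `[lo, hi]`, where `lo` is covered by `hi`. -/
@[ext]
structure PrimeInterval (L : Type*) [Lattice L] where
  lo : L
  hi : L
  covBy : lo ⋖ hi

/-- The least lattice congruence collapsing `a` and `b`: the intersection of all lattice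
congruences collapsing them. -/
def con {L : Type*} [Lattice L] (a b : L) : LatticeCon L where
  r x y := ∀ θ : LatticeCon L, θ.r a b → θ.r x y
  iseqv :=
    { refl := fun x θ _ => θ.iseqv.refl x
      symm := fun h θ hθ => θ.iseqv.symm (h θ hθ)
      trans := fun h h' θ hθ => θ.iseqv.trans (h θ hθ) (h' θ hθ) }
  inf h h' := fun θ hθ => θ.inf (h θ hθ) (h' θ hθ)
  sup h h' := fun θ hθ => θ.sup (h θ hθ) (h' θ hθ)

/-- A planar Hasse diagram: the elements are distinct points of the plane, larger elements are
higher, each covering pair is joined by a straight line segment, an edge passes through no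
vertex other than its two endpoints, and two distinct edges meet only in a common endpoint. -/
structure PlanarDiagram (L : Type*) [Lattice L] where
  pos : L → ℝ × ℝ
  pos_injective : Function.Injective pos
  height_lt : ∀ ⦃a b : L⦄, a < b → (pos a).2 < (pos b).2
  vertex_edge : ∀ ⦃a b v : L⦄, a ⋖ b → pos v ∈ segment ℝ (pos a) (pos b) → v = a ∨ v = b
  edge_edge : ∀ ⦃a b c d : L⦄, a ⋖ b → c ⋖ d → (a, b) ≠ (c, d) →
    segment ℝ (pos a) (pos b) ∩ segment ℝ (pos c) (pos d) ⊆ pos '' ({a, b} ∩ {c, d})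

namespace PlanarDiagram

variable {L : Type*} [Lattice L] (D : PlanarDiagram L)

/-- `x` is on the left of the chain `C` (or on `C`): at the height of `x`, the polygonal line
formed by the edges of `C` has a point whose first coordinate is at least that of `x`. -/
def LeftOfChain (C : Set L) (x : L) : Prop :=
  ∃ u ∈ C, ∃ v ∈ C, u ⋖ v ∧ ∃ t ∈ segment ℝ (D.pos u) (D.pos v),
    t.2 = (D.pos x).2 ∧ (D.pos x).1 ≤ t.1

/-- `x` is on the right of the chain `C` (or on `C`). -/
def RightOfChain (C : Set L) (x : L) : Prop :=
  ∃ u ∈ C, ∃ v ∈ C, u ⋖ v ∧ ∃ t ∈ segment ℝ (D.pos u) (D.pos v),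
    t.2 = (D.pos x).2 ∧ t.1 ≤ (D.pos x).1

/-- `C` is a maximal chain in the interval `[a, b]`. -/
def IsMaxChainIn (a b : L) (C : Set L) : Prop :=
  Maximal (fun E : Set L => E ⊆ Set.Icc a b ∧ IsChain (· ≤ ·) E) C

/-- `R` is a region: for some `a < b` with `b` not covering `a`, it consists of the elements of
`[a, b]` between two maximal chains `C₁` and `C₂` of `[a, b]` that meet only in `a` and `b`,
with `C₂` on the right of `C₁`. -/
def IsRegion (R : Set L) : Prop :=
  ∃ (a b : L) (C₁ C₂ : Set L), a < b ∧ ¬ a ⋖ b ∧ IsMaxChainIn a b C₁ ∧ IsMaxChainIn a b C₂ ∧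
    C₁ ∩ C₂ = {a, b} ∧ (∀ x ∈ C₂ \ {a, b}, D.RightOfChain C₁ x) ∧
    R = {x | x ∈ Set.Icc a b ∧ D.RightOfChain C₁ x ∧ D.LeftOfChain C₂ x}

/-- A cell is a minimal region. -/
def IsCell (S : Set L) : Prop :=
  Minimal D.IsRegion S

/-- A 4-cell is a cell with four vertices. (As both bounding chains of a region have an inner
element, such a cell has one inner element on each side, and hence four edges.) -/
def IsFourCell (S : Set L) : Prop :=
  D.IsCell S ∧ S.ncard = 4

/-- The horizontal displacement per unit of descent along the edge from `z` down to its lower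
cover `a`; the lower covers of `z` are listed from left to right as this number increases. -/
noncomputable def descentSlope (z a : L) : ℝ :=
  ((D.pos a).1 - (D.pos z).1) / ((D.pos z).2 - (D.pos a).2)

/-- `a` is the leftmost lower cover of `z`. -/
def IsLeftmostLowerCover (z a : L) : Prop :=
  a ⋖ z ∧ ∀ a', a' ⋖ z → D.descentSlope z a ≤ D.descentSlope z a'

/-- `a` is the rightmost lower cover of `z`. -/
def IsRightmostLowerCover (z a : L) : Prop :=
  a ⋖ z ∧ ∀ a', a' ⋖ z → D.descentSlope z a' ≤ D.descentSlope z a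

/-- The prime interval `r` is an edge of the set `S` of elements (used for 4-cells `S`). -/
def EdgeOf (r : PrimeInterval L) (S : Set L) : Prop :=
  r.lo ∈ S ∧ r.hi ∈ S

/-- `r` is cell-perspective to `s`: they are opposite sides of some 4-cell, that is, two sides
without a common endpoint. -/
def CellPerspective (r s : PrimeInterval L) : Prop :=
  ∃ S : Set L, D.IsFourCell S ∧ EdgeOf r S ∧ EdgeOf s S ∧
    Disjoint ({r.lo, r.hi} : Set L) {s.lo, s.hi}

/-- `r` swings to `s`: they are distinct edges of the same 4-cell with a common top, this top has
at least three lower covers, and the bottom of `s` is neither the leftmost nor the rightmost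
lower cover of it. -/
def Swings (r s : PrimeInterval L) : Prop :=
  r ≠ s ∧ (∃ S : Set L, D.IsFourCell S ∧ EdgeOf r S ∧ EdgeOf s S) ∧
    r.hi = s.hi ∧ 3 ≤ {x : L | x ⋖ r.hi}.ncard ∧
    ¬ D.IsLeftmostLowerCover r.hi s.lo ∧ ¬ D.IsRightmostLowerCover r.hi s.lo

/-- The sequence `r 0, …, r n` of prime intervals is an SS-sequence: each member is
cell-perspective to or swings to the next one. -/
def IsSSSequence {n : ℕ} (r : Fin (n + 1) → PrimeInterval L) : Prop :=
  ∀ i : Fin n, D.CellPerspective (r i.castSucc) (r i.succ) ∨ D.Swings (r i.castSucc) (r i.succ)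

end PlanarDiagram

end SwingLemma

/-! Existence of a diagram: slimness splits the join-irreducibles into two chains (Dilworth). An
element is determined by the join-irreducibles below it, so counting those in each chain embeds the
order into the product order of the plane. Turned by 45 degrees, this embedding is a planar diagram.

SS-sequences stay inside the congruence: opposite sides of a 4-cell are perspective, and a swing is
realised by a meet followed by a join. The latter rests on planarity: a lower cover of `z` lying
between two others is above their meet (`inf_le_of_descentSlope_lt`).

Conversely, let `E` be the set of edges reachable from `p`. Relate `x` and `y` when some covering
chain from `x ⊓ y` to `x ⊔ y` has all its edges in `E`. This relation is a congruence, hence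
contains `con p.lo p.hi`, and an edge collapsed by it belongs to `E`. Compatibility with joins comes
from pushing an edge upwards through the 4-cells that semimodularity and slimness provide. For
meets, fix the top `z` of an edge in `E` and move through the lower covers of `z` from neighbour to
neighbour: neighbours span a 4-cell (`inf_covBy_of_adjacent`), swings keep the inner edges under `z`
in `E`, and cell-perspectivity then yields edges further down. The abstract conditions on `E` that
this needs are collected in `IsSwingClosed`. -/

namespace SwingLemma

/-! ### Chain covers of the join-irreducibles and order dimension two -/

/-- Dilworth's theorem for width two: a finite set without three pairwise incomparable elements
is covered by two chains. -/
theorem exists_isChain_cover_of_no_three_antichain {α : Type*} [PartialOrder α] [DecidableEq α]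
    (S : Finset α)
    (hS : ∀ a ∈ S, ∀ b ∈ S, ∀ c ∈ S, ¬ a ≤ b → ¬ b ≤ a → ¬ b ≤ c → ¬ c ≤ b → ¬ a ≤ c →
      ¬ c ≤ a → False) :
    ∃ A B : Set α, (S : Set α) = A ∪ B ∧ IsChain (· ≤ ·) A ∧ IsChain (· ≤ ·) B := by
  classical
  induction hn : S.card generalizing S with
  | zero =>
    refine ⟨∅, ∅, ?_, by simp, by simp⟩
    simpa using hn
  | succ n ih =>
    have hne : S.Nonempty := Finset.card_pos.1 (by omega)
    obtain ⟨a, ha⟩ := S.exists_maximal hne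
    have hmax : ∀ z ∈ S, a ≤ z → z = a := fun z hz haz => le_antisymm (ha.2 hz haz) haz
    obtain ⟨A, B, hAB, hA, hB⟩ := ih (S.erase a)
      (fun x hx y hy z hz => hS x (Finset.mem_of_mem_erase hx) y (Finset.mem_of_mem_erase hy) z
        (Finset.mem_of_mem_erase hz)) (by rw [Finset.card_erase_of_mem ha.1]; omega)
    have hmem : ∀ z, z ∈ A ∪ B ↔ z ≠ a ∧ z ∈ S := fun z => by
      rw [← hAB]; simp [and_comm]
    have hins : (S : Set α) = insert a (A ∪ B) := by
      ext z
      simp only [Set.mem_insert_iff, hmem, Finset.mem_coe]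
      constructor
      · intro h; by_cases hz : z = a
        · exact Or.inl hz
        · exact Or.inr ⟨hz, h⟩
      · rintro (rfl | h)
        · exact ha.1
        · exact h.2
    -- If `x ≤ a` and every element of `A` above `x` is comparable with all of `B`, that upper part
    -- of `A` can be moved over to `B`, which makes room for `a` on top of the rest of `A`.
    have split : ∀ A B : Set α, IsChain (· ≤ ·) A → IsChain (· ≤ ·) B →
        (S : Set α) = insert a (A ∪ B) → ∀ x ∈ A, x ≤ a →
        (∀ z ∈ A, x < z → ∀ y ∈ B, z ≤ y ∨ y ≤ z) →
        ∃ A B : Set α, (S : Set α) = A ∪ B ∧ IsChain (· ≤ ·) A ∧ IsChain (· ≤ ·) B := by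
      intro A B hA hB hS x hx hxa hz
      refine ⟨insert a {z ∈ A | z ≤ x}, B ∪ {z ∈ A | x < z}, ?_, ?_, ?_⟩
      · rw [hS]
        ext z
        simp only [Set.mem_insert_iff, Set.mem_union, Set.mem_ofPred_eq]
        have : z ∈ A → z ≤ x ∨ x < z := fun h => by
          rcases hA.total h hx with h' | h'
          · exact Or.inl h'
          · exact (eq_or_lt_of_le h').imp (fun h => h.ge) id
        tauto
      · refine (hA.mono fun z hz => hz.1).insert fun z hz _ => Or.inr (hz.2.trans hxa)
      · intro y hy z hz' hne
        rcases hy with hy | hy <;> rcases hz' with hz' | hz'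
        · exact hB hy hz' hne
        · exact (hz z hz'.1 hz'.2 y hy).symm
        · exact hz y hy.1 hy.2 z hz'
        · exact hA hy.1 hz'.1 hne
    by_cases hch : ∀ x ∈ A, ∀ y ∈ B, x ≤ y ∨ y ≤ x
    · refine ⟨{a}, A ∪ B, by rw [hins]; rfl, by simp, ?_⟩
      intro x hx y hy hne
      rcases hx with hx | hx <;> rcases hy with hy | hy
      · exact hA hx hy hne
      · exact hch x hx y hy
      · exact (hch y hy x hx).symm
      · exact hB hx hy hne
    · push Not at hch
      obtain ⟨x₁, hx₁, y₁, hy₁, hxy₁, hyx₁⟩ := hch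
      have hfinA : A.Finite := (S.erase a).finite_toSet.subset (by rw [hAB]; simp)
      have hfinB : B.Finite := (S.erase a).finite_toSet.subset (by rw [hAB]; simp)
      -- `x` and `y` are the topmost elements of their chains that are incomparable with something
      -- in the other chain. They turn out to be incomparable with each other, so, `a` being maximal
      -- and three-element antichains being excluded, one of them lies below `a`.
      obtain ⟨x, hx⟩ := (hfinA.subset (Set.sep_subset A fun x => ∃ y ∈ B, ¬ x ≤ y ∧ ¬ y ≤ x)
        ).exists_maximal ⟨x₁, hx₁, y₁, hy₁, hxy₁, hyx₁⟩
      obtain ⟨y, hy⟩ := (hfinB.subset (Set.sep_subset B fun y => ∃ x ∈ A, ¬ x ≤ y ∧ ¬ y ≤ x)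
        ).exists_maximal ⟨y₁, hy₁, x₁, hx₁, hxy₁, hyx₁⟩
      have hxm : ∀ z ∈ A, x < z → ∀ y ∈ B, z ≤ y ∨ y ≤ z := by
        intro z hz hxz y hy
        by_contra! h
        exact hxz.not_ge (hx.2 ⟨hz, y, hy, h.1, h.2⟩ hxz.le)
      have hym : ∀ z ∈ B, y < z → ∀ x ∈ A, z ≤ x ∨ x ≤ z := by
        intro z hz hyz x hx
        by_contra! h
        exact hyz.not_ge (hy.2 ⟨hz, x, hx, h.2, h.1⟩ hyz.le)
      obtain ⟨⟨hxA, y', hy'B, hxy', hyx'⟩, -⟩ := hx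
      obtain ⟨⟨hyB, x', hx'A, hxy'', hyx''⟩, -⟩ := hy
      have hxS := (hmem x).1 (Or.inl hxA)
      have hyS := (hmem y).1 (Or.inr hyB)
      have hx'x : x' ≤ x := by
        rcases hA.total hx'A hxA with h | h
        · exact h
        · rcases eq_or_lt_of_le h with h | h
          · exact h.ge
          · exact absurd (hxm x' hx'A h y hyB) (by tauto)
      have hy'y : y' ≤ y := by
        rcases hB.total hy'B hyB with h | h
        · exact h
        · rcases eq_or_lt_of_le h with h | h
          · exact h.ge
          · exact absurd (hym y' hy'B h x hxA) (by tauto)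
      have h1 : ¬ x ≤ y := fun h => hxy'' (hx'x.trans h)
      have h2 : ¬ y ≤ x := fun h => hyx' (hy'y.trans h)
      by_cases hxa : x ≤ a
      · exact split A B hA hB hins x hxA hxa hxm
      by_cases hya : y ≤ a
      · exact split B A hB hA (by rw [hins, Set.union_comm]) y hyB hya hym
      exact (hS a ha.1 x hxS.2 y hyS.2 (fun h => hxS.1 (hmax x hxS.2 h)) hxa h1 h2
        (fun h => hyS.1 (hmax y hyS.2 h)) hya).elim

theorem ncard_le_of_le {α : Type*} [PartialOrder α] [Finite α] (A : Set α) {x y : α}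
    (h : x ≤ y) : {j ∈ A | j ≤ x}.ncard ≤ {j ∈ A | j ≤ y}.ncard :=
  Set.ncard_le_ncard (fun _ hj => ⟨hj.1, hj.2.trans h⟩) (Set.toFinite _)

/-- Initial segments of a chain are nested, so comparing their sizes already compares them as sets.
-/
theorem IsChain.le_of_ncard_le {α : Type*} [PartialOrder α] [Finite α] {A : Set α}
    (hA : IsChain (· ≤ ·) A) {x y : α} (h : {j ∈ A | j ≤ x}.ncard ≤ {j ∈ A | j ≤ y}.ncard)
    {j : α} (hj : j ∈ A) (hjx : j ≤ x) : j ≤ y := by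
  by_contra hjy
  refine h.not_gt (Set.ncard_lt_ncard ⟨?_, ?_⟩ (Set.toFinite _))
  · rintro k ⟨hk, hky⟩
    refine ⟨hk, ?_⟩
    rcases hA.total hk hj with h' | h'
    · exact h'.trans hjx
    · exact (hjy (h'.trans hky)).elim
  · intro hsub
    exact hjy (hsub (show j ∈ {j ∈ A | j ≤ x} from ⟨hj, hjx⟩)).2

theorem IsSlim.false_of_incomparable {L : Type*} [Lattice L] (hslim : IsSlim L) {a b c : L}
    (ha : SupIrred a) (hb : SupIrred b) (hc : SupIrred c) (hab : ¬ a ≤ b) (hba : ¬ b ≤ a)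
    (hbc : ¬ b ≤ c) (hcb : ¬ c ≤ b) (hac : ¬ a ≤ c) (hca : ¬ c ≤ a) : False := by
  classical
  refine hslim ⟨{a, b, c}, ?_, ?_, ?_⟩
  · rw [Finset.card_eq_three]
    exact ⟨a, b, c, by rintro rfl; exact hab le_rfl, by rintro rfl; exact hac le_rfl,
      by rintro rfl; exact hbc le_rfl, rfl⟩
  · simp [ha, hb, hc]
  · intro x hx y hy hne
    simp only [Finset.coe_insert, Finset.coe_singleton, Set.mem_insert_iff,
      Set.mem_singleton_iff] at hx hy
    rcases hx with rfl | rfl | rfl <;> rcases hy with rfl | rfl | rfl <;>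
      first | exact (hne rfl).elim | assumption

theorem exists_supIrred_le_not_le {L : Type*} [Lattice L] [Finite L] {x y : L} (h : ¬ x ≤ y) :
    ∃ j, SupIrred j ∧ j ≤ x ∧ ¬ j ≤ y := by
  have : Nonempty L := ⟨x⟩
  let _ : Fintype L := Fintype.ofFinite L
  let _ : OrderBot L := Fintype.toOrderBot L
  obtain ⟨s, hs, hirr⟩ := exists_supIrred_decomposition x
  by_contra! hall
  refine h ?_
  rw [← hs, Finset.sup_le_iff]
  exact fun j hj => hall j (hirr hj) (hs ▸ Finset.le_sup (f := id) hj)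

/-- A finite slim lattice has order dimension at most two. -/
theorem IsSlim.exists_dominance {L : Type*} [Lattice L] [Finite L] (hslim : IsSlim L) :
    ∃ f g : L → ℝ, ∀ x y, x ≤ y ↔ f x ≤ f y ∧ g x ≤ g y := by
  classical
  obtain ⟨A, B, hAB, hA, hB⟩ := exists_isChain_cover_of_no_three_antichain
    (Set.toFinite {x : L | SupIrred x}).toFinset (by
      intro a ha b hb c hc
      simp only [Set.Finite.mem_toFinset, Set.mem_ofPred_eq] at ha hb hc
      exact hslim.false_of_incomparable ha hb hc)
  have hmem : ∀ x : L, x ∈ A ∪ B ↔ SupIrred x := fun x => by rw [← hAB]; simp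
  -- The two coordinates count the join-irreducibles below `x` in each of the two chains.
  refine ⟨fun x => {j ∈ A | j ≤ x}.ncard, fun x => {j ∈ B | j ≤ x}.ncard, fun x y => ?_⟩
  simp only [Nat.cast_le]
  refine ⟨fun h => ⟨ncard_le_of_le A h, ncard_le_of_le B h⟩, fun ⟨hf, hg⟩ => ?_⟩
  by_contra hxy
  obtain ⟨j, hj, hjx, hjy⟩ := exists_supIrred_le_not_le hxy
  rcases (hmem j).2 hj with h | h
  · exact hjy (IsChain.le_of_ncard_le hA hf h hjx)
  · exact hjy (IsChain.le_of_ncard_le hB hg h hjx)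

/-! ### Dominance drawings are planar -/

/-- The coordinates of a point of the segment from `u` to `v` lie between those of `u` and `v`. -/
theorem coord_mem_of_mem_segment {u v p : ℝ × ℝ} (hp : p ∈ segment ℝ u v)
    (φ : ℝ × ℝ →ₗ[ℝ] ℝ) (h : φ u ≤ φ v) : φ u ≤ φ p ∧ φ p ≤ φ v := by
  obtain ⟨s, t, hs, ht, hst, rfl⟩ := hp
  simp only [map_add, map_smul, smul_eq_mul]
  obtain rfl : s = 1 - t := by linarith
  constructor <;> nlinarith

/-- Two segments with a common starting point that meet again: one end point lies on the other
segment. -/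
theorem mem_segment_of_mem_segment {o u v p : ℝ × ℝ} (hpo : p ≠ o) (hu : p ∈ segment ℝ o u)
    (hv : p ∈ segment ℝ o v) : u ∈ segment ℝ o v ∨ v ∈ segment ℝ o u := by
  rw [segment_eq_image'] at hu hv
  obtain ⟨s, ⟨hs0, hs1⟩, rfl⟩ := hu
  obtain ⟨t, ⟨ht0, ht1⟩, ht⟩ := hv
  simp only [add_right_inj] at ht
  have hs : 0 < s := hs0.lt_of_ne (by rintro rfl; simp at hpo)
  have ht' : 0 < t := ht0.lt_of_ne (by
    rintro rfl
    rw [zero_smul] at ht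
    simp [← ht] at hpo)
  have key : ∀ (s t : ℝ) (w z : ℝ × ℝ), 0 < s → 0 < t → s ≤ t → t • w = s • z →
      ∃ θ ∈ Set.Icc (0 : ℝ) 1, w = θ • z := by
    intro s t w z hs ht hst h
    refine ⟨s / t, ⟨by positivity, (div_le_one ht).2 hst⟩, ?_⟩
    rw [div_eq_inv_mul, mul_smul, ← h, smul_smul, inv_mul_cancel₀ ht.ne', one_smul]
  rcases le_total s t with h | h
  · obtain ⟨θ, hθ, h'⟩ := key s t _ _ hs ht' h ht
    exact Or.inr (by rw [segment_eq_image']; exact ⟨θ, hθ, by simp [← h']⟩)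
  · obtain ⟨θ, hθ, h'⟩ := key t s _ _ ht' hs h ht.symm
    exact Or.inl (by rw [segment_eq_image']; exact ⟨θ, hθ, by simp [← h']⟩)

/-- A dominance drawing of a lattice is a planar Hasse diagram. -/
theorem nonempty_planarDiagram_of_dominance {L : Type*} [Lattice L] (f g : L → ℝ)
    (hfg : ∀ x y, x ≤ y ↔ f x ≤ f y ∧ g x ≤ g y) : Nonempty (PlanarDiagram L) := by
  -- The plane is turned by 45 degrees, so that height is `f + g`. Up to a factor 2, the functionals
  -- `φ` and `ψ` recover `f` and `g`, and so extend the order to all points of the plane.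
  let pos : L → ℝ × ℝ := fun x => (g x - f x, f x + g x)
  let φ : ℝ × ℝ →ₗ[ℝ] ℝ := LinearMap.snd ℝ ℝ ℝ - LinearMap.fst ℝ ℝ ℝ
  let ψ : ℝ × ℝ →ₗ[ℝ] ℝ := LinearMap.snd ℝ ℝ ℝ + LinearMap.fst ℝ ℝ ℝ
  have hφ : ∀ x, φ (pos x) = 2 * f x := fun x => by simp [φ, pos]; ring
  have hψ : ∀ x, ψ (pos x) = 2 * g x := fun x => by simp [ψ, pos]; ring
  have hinj : Function.Injective pos := by
    intro x y h
    have h1 := congrArg φ h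
    have h2 := congrArg ψ h
    rw [hφ, hφ] at h1
    rw [hψ, hψ] at h2
    apply le_antisymm <;> rw [hfg] <;> constructor <;> linarith
  have hle : ∀ x y, x ≤ y ↔ φ (pos x) ≤ φ (pos y) ∧ ψ (pos x) ≤ ψ (pos y) := fun x y => by
    rw [hfg, hφ, hφ, hψ, hψ]; simp
  have hseg : ∀ {a b : L} {p}, a ≤ b → p ∈ segment ℝ (pos a) (pos b) →
      (φ (pos a) ≤ φ p ∧ φ p ≤ φ (pos b)) ∧ (ψ (pos a) ≤ ψ p ∧ ψ p ≤ ψ (pos b)) :=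
    fun hab hp => ⟨coord_mem_of_mem_segment hp φ ((hle _ _).1 hab).1,
      coord_mem_of_mem_segment hp ψ ((hle _ _).1 hab).2⟩
  have hvert : ∀ ⦃a b v : L⦄, a ⋖ b → pos v ∈ segment ℝ (pos a) (pos b) → v = a ∨ v = b := by
    intro a b v hab hv
    obtain ⟨⟨h1, h2⟩, h3, h4⟩ := hseg hab.le hv
    exact hab.eq_or_eq ((hle _ _).2 ⟨h1, h3⟩) ((hle _ _).2 ⟨h2, h4⟩)
  refine ⟨⟨pos, hinj, ?_, hvert, ?_⟩⟩
  · intro a b hab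
    have h1 := (hfg a b).1 hab.le
    have h2 := mt (hfg b a).2 hab.not_ge
    simp only [pos]
    by_contra h
    exact h2 ⟨by linarith, by linarith⟩
  · rintro a b c d hab hcd hne p ⟨hp, hp'⟩
    obtain ⟨⟨h1, h2⟩, h3, h4⟩ := hseg hab.le hp
    obtain ⟨⟨h5, h6⟩, h7, h8⟩ := hseg hcd.le hp'
    have had : a ≤ d := (hle _ _).2 ⟨h1.trans h6, h3.trans h8⟩
    have hcb : c ≤ b := (hle _ _).2 ⟨h5.trans h2, h7.trans h4⟩
    have heq : ∀ {u v : L}, v ≤ u → φ (pos u) ≤ φ p → φ p ≤ φ (pos v) →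
        ψ (pos u) ≤ ψ p → ψ p ≤ ψ (pos v) → pos u = p := by
      intro u v huv a1 a2 a3 a4
      have := (hle _ _).1 huv
      have e1 : φ (pos u) = φ p := by linarith
      have e2 : ψ (pos u) = ψ p := by linarith
      simp only [φ, ψ, LinearMap.sub_apply, LinearMap.add_apply, LinearMap.fst_apply,
        LinearMap.snd_apply] at e1 e2
      ext <;> linarith
    by_cases hda : d = a
    · subst hda
      exact ⟨d, by simp, heq le_rfl h1 h6 h3 h8⟩
    by_cases hbc : b = c
    · subst hbc
      exact ⟨b, by simp, heq le_rfl h5 h2 h7 h4⟩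
    by_cases hac : a = c
    · subst hac
      have hbd : b ≠ d := fun h => hne (by rw [h])
      refine ⟨a, by simp, ?_⟩
      by_contra hpa
      -- Two edges with a common end that meet again overlap, which puts the far end of one on the
      -- other, against `hvert`.
      rcases mem_segment_of_mem_segment (Ne.symm hpa) hp hp' with h | h
      · rcases hvert hcd h with h | h
        · exact hab.lt.ne' h
        · exact hbd h
      · rcases hvert hab h with h | h
        · exact hcd.lt.ne' h
        · exact hbd h.symm
    by_cases hbd : b = d
    · subst hbd
      refine ⟨b, by simp, ?_⟩
      by_contra hpb
      rw [segment_symm] at hp hp'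
      rcases mem_segment_of_mem_segment (Ne.symm hpb) hp hp' with h | h
      · rw [segment_symm] at h
        rcases hvert hcd h with h | h
        · exact hac h
        · exact hab.lt.ne h
      · rw [segment_symm] at h
        rcases hvert hab h with h | h
        · exact hac h.symm
        · exact hcd.lt.ne h
    · exfalso
      -- Passing through `p` gave `a ≤ d` and `c ≤ b`, so `a ⊔ c` lies in both edges and hence is an
      -- end of each, although by now they have no common end.
      rcases hab.eq_or_eq (le_sup_left : a ≤ a ⊔ c) (sup_le hab.le hcb) with h | h <;>
      rcases hcd.eq_or_eq (le_sup_right : c ≤ a ⊔ c) (sup_le had hcd.le) with h' | h' <;>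
      rw [h] at h'
      · exact hac h'
      · exact hda h'.symm
      · exact hbc h'
      · exact hbd h'

/-! ### Polygonal lines of chains, and betweenness of lower covers -/

/-- The covering relation restricted to the set `C`. -/
def Step {L : Type*} [Lattice L] (C : Set L) (x y : L) : Prop :=
  x ∈ C ∧ y ∈ C ∧ x ⋖ y

theorem Step.reflTransGen_le {L : Type*} [Lattice L] {C : Set L} {x y : L}
    (h : Relation.ReflTransGen (Step C) x y) : x ≤ y := by
  induction h with
  | refl => exact le_rfl
  | tail _ h ih => exact ih.trans h.2.2.le

theorem reflTransGen_step_of_le {L : Type*} [Lattice L] [Finite L] {C : Set L} {x y : L}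
    (hxy : x ≤ y) (hC : Set.Icc x y ⊆ C) : Relation.ReflTransGen (Step C) x y := by
  induction x using WellFoundedGT.induction with
  | ind x ih =>
    rcases hxy.eq_or_lt with rfl | hlt
    · exact .refl
    · obtain ⟨z, hxz, hzy⟩ := exists_covBy_le_of_lt hlt
      exact .head ⟨hC ⟨le_rfl, hxy⟩, hC ⟨hxz.le, hzy⟩, hxz⟩
        (ih z hxz.lt hzy ((Set.Icc_subset_Icc_left hxz.le).trans hC))

/-- A continuous function that avoids zero keeps its sign on a convex set. -/
theorem neg_of_ne_zero_of_neg {f : ℝ → ℝ} (hf : Continuous f) {s : Set ℝ} (hs : s.OrdConnected)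
    (hne : ∀ h ∈ s, f h ≠ 0) {p q : ℝ} (hp : p ∈ s) (hq : q ∈ s) (hfp : f p < 0) : f q < 0 := by
  by_contra! h
  obtain ⟨r, hr, hr0⟩ := (hs.isPreconnected.image f hf.continuousOn).ordConnected.out
    ⟨p, hp, rfl⟩ ⟨q, hq, rfl⟩ ⟨hfp.le, h⟩
  exact hne r hr hr0

namespace PlanarDiagram

variable {L : Type*} [Lattice L] (D : PlanarDiagram L)

/-- The first coordinate at height `h` of the line through the edge from `b` up to `c`. -/
noncomputable def edgeLine (b c : L) (h : ℝ) : ℝ :=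
  (D.pos c).1 + D.descentSlope c b * ((D.pos c).2 - h)

theorem continuous_edgeLine (b c : L) : Continuous (D.edgeLine b c) := by
  unfold edgeLine; fun_prop

theorem edgeLine_top (b c : L) : D.edgeLine b c (D.pos c).2 = (D.pos c).1 := by
  simp [edgeLine]

theorem edgeLine_bot {b c : L} (hbc : b < c) : D.edgeLine b c (D.pos b).2 = (D.pos b).1 := by
  have := D.height_lt hbc
  have : (D.pos c).2 - (D.pos b).2 ≠ 0 := by linarith
  rw [edgeLine, descentSlope, div_mul_cancel₀ _ this]
  ring

theorem edgeLine_mem_segment {b c : L} (hbc : b < c) {h : ℝ} (h1 : (D.pos b).2 ≤ h)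
    (h2 : h ≤ (D.pos c).2) : (D.edgeLine b c h, h) ∈ segment ℝ (D.pos b) (D.pos c) := by
  have hlt := D.height_lt hbc
  have hne : (D.pos c).2 - (D.pos b).2 ≠ 0 := by linarith
  rw [segment_eq_image']
  refine ⟨(h - (D.pos b).2) / ((D.pos c).2 - (D.pos b).2),
    ⟨div_nonneg (by linarith) (by linarith), (div_le_one (by linarith)).2 (by linarith)⟩, ?_⟩
  ext
  · simp only [edgeLine, descentSlope, Prod.fst_add, Prod.smul_fst, Prod.fst_sub, smul_eq_mul]
    field_simp
    ring
  · simp only [Prod.snd_add, Prod.smul_snd, Prod.snd_sub, smul_eq_mul]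
    field_simp
    ring

theorem eq_edgeLine_of_mem_segment {b c : L} (hbc : b < c) {p : ℝ × ℝ}
    (hp : p ∈ segment ℝ (D.pos b) (D.pos c)) : p.1 = D.edgeLine b c p.2 := by
  have hlt := D.height_lt hbc
  have hne : (D.pos c).2 - (D.pos b).2 ≠ 0 := by linarith
  rw [segment_eq_image'] at hp
  obtain ⟨θ, -, rfl⟩ := hp
  simp only [edgeLine, descentSlope, Prod.fst_add, Prod.smul_fst, Prod.fst_sub, smul_eq_mul,
    Prod.snd_add, Prod.smul_snd, Prod.snd_sub]
  field_simp
  ring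

theorem height_le {a b : L} (h : a ≤ b) : (D.pos a).2 ≤ (D.pos b).2 := by
  rcases h.eq_or_lt with rfl | h
  · exact le_rfl
  · exact (D.height_lt h).le

theorem height_mem_of_mem_segment {b c : L} (hbc : b ≤ c) {p : ℝ × ℝ}
    (hp : p ∈ segment ℝ (D.pos b) (D.pos c)) : (D.pos b).2 ≤ p.2 ∧ p.2 ≤ (D.pos c).2 :=
  coord_mem_of_mem_segment hp (LinearMap.snd ℝ ℝ ℝ) (D.height_le hbc)

/-- The polygonal line formed by the edges of a covering chain is the graph of a continuous
function of the height. -/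
theorem exists_continuous_path {C : Set L} {a b c : L}
    (hab : Relation.ReflTransGen (Step C) a b) (hbc : Step C b c) :
    ∃ f : ℝ → ℝ, Continuous f ∧ f (D.pos a).2 = (D.pos a).1 ∧
      (∀ h, (D.pos b).2 ≤ h → f h = D.edgeLine b c h) ∧
      ∀ h ∈ Set.Icc (D.pos a).2 (D.pos c).2, ∃ d e, Step C d e ∧ a ≤ d ∧ e ≤ c ∧
        (f h, h) ∈ segment ℝ (D.pos d) (D.pos e) := by
  induction hab generalizing c with
  | refl =>
    exact ⟨D.edgeLine a c, D.continuous_edgeLine a c, D.edgeLine_bot hbc.2.2.lt,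
      fun _ _ => rfl, fun h hh => ⟨a, c, hbc, le_rfl, le_rfl,
        D.edgeLine_mem_segment hbc.2.2.lt hh.1 hh.2⟩⟩
  | @tail b b' hab hbb' ih =>
    obtain ⟨f, hf, hfa, hfb, hfm⟩ := ih hbb'
    have hjoin : f (D.pos b').2 = (D.pos b').1 := by
      rw [hfb _ (D.height_le hbb'.2.2.le), D.edgeLine_top]
    have hab' : a < b' := (Step.reflTransGen_le hab).trans_lt hbb'.2.2.lt
    -- The old path is cut at the height of `b'` and continued along the full line of the new edge;
    -- the two pieces agree at `b'`.
    refine ⟨fun h => if h ≤ (D.pos b').2 then f h else D.edgeLine b' c h, ?_, ?_, ?_, ?_⟩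
    · refine hf.if_le (D.continuous_edgeLine b' c) continuous_id continuous_const ?_
      intro h hh
      rw [show h = (D.pos b').2 from hh, hjoin, D.edgeLine_bot hbc.2.2.lt]
    · simp only [if_pos (D.height_le hab'.le), hfa]
    · intro h hh
      rcases hh.eq_or_lt with rfl | hh
      · simp only [le_refl, if_true, hjoin, D.edgeLine_bot hbc.2.2.lt]
      · simp only [if_neg hh.not_ge]
    · intro h hh
      by_cases hle : h ≤ (D.pos b').2
      · obtain ⟨d, e, hde, had, heb, hm⟩ := hfm h ⟨hh.1, hle⟩
        exact ⟨d, e, hde, had, heb.trans hbc.2.2.le, by simpa only [if_pos hle] using hm⟩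
      · refine ⟨b', c, hbc, hab'.le, le_rfl, ?_⟩
        simp only [if_neg hle]
        exact D.edgeLine_mem_segment hbc.2.2.lt (not_le.1 hle).le hh.2

/-- Edges through a common point are equal, or the point is a common vertex of them. -/
theorem eq_or_exists_common_vertex {a b c d : L} (hab : a ⋖ b) (hcd : c ⋖ d) {p : ℝ × ℝ}
    (hp : p ∈ segment ℝ (D.pos a) (D.pos b)) (hp' : p ∈ segment ℝ (D.pos c) (D.pos d)) :
    (a = c ∧ b = d) ∨ ∃ v, D.pos v = p ∧ (v = a ∨ v = b) ∧ (v = c ∨ v = d) := by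
  by_cases h : (a, b) = (c, d)
  · exact Or.inl (Prod.mk.inj h)
  · obtain ⟨v, ⟨h1, h2⟩, hv⟩ := D.edge_edge hab hcd h ⟨hp, hp'⟩
    exact Or.inr ⟨v, hv, h1, h2⟩

/-- Edges below `z` of equal slope lie on one line and so share a point at the height of the higher
of the two lower ends. It is strictly below `z`, so either the edges are equal or the point is a
common lower end. -/
theorem descentSlope_injOn {z a b : L} (ha : a ⋖ z) (hb : b ⋖ z)
    (h : D.descentSlope z a = D.descentSlope z b) : a = b := by
  have hya := D.height_lt ha.lt
  have hyb := D.height_lt hb.lt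
  have hmax := max_lt hya hyb
  have hl : D.edgeLine a z = D.edgeLine b z := by
    ext t; simp only [edgeLine, h]
  have h1 := D.edgeLine_mem_segment ha.lt (le_max_left (D.pos a).2 (D.pos b).2) hmax.le
  have h2 := D.edgeLine_mem_segment hb.lt (le_max_right (D.pos a).2 (D.pos b).2) hmax.le
  rw [← hl] at h2
  rcases D.eq_or_exists_common_vertex ha hb h1 h2 with h | ⟨v, hv, h1, h2⟩
  · exact h.1
  · have hvz : v ≠ z := by
      rintro rfl
      exact hmax.ne' (congrArg Prod.snd hv)
    rw [← h1.resolve_right hvz, h2.resolve_right hvz]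

/-- A lower cover of `z` between two others contains their meet. -/
theorem inf_le_of_descentSlope_lt [Finite L] {z a m b : L} (ha : a ⋖ z) (hm : m ⋖ z) (hb : b ⋖ z)
    (ham : D.descentSlope z a < D.descentSlope z m)
    (hmb : D.descentSlope z m < D.descentSlope z b) : a ⊓ b ≤ m := by
  -- Two paths lead from `u` to `z`, one through `a` and one through `b`, with all vertices above
  -- `u`. A third path through `m` has all vertices other than `z` below `m`. If `u` is not below
  -- `m`, the third cannot meet the first two below `z`; but it runs between them just below `z`,
  -- while they come together at `u`.
  by_contra hum
  set u := a ⊓ b with hu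
  have path : ∀ x, x ⋖ z → u ≤ x → ∃ f : ℝ → ℝ, Continuous f ∧ f (D.pos u).2 = (D.pos u).1 ∧
      (∀ h, (D.pos x).2 ≤ h → f h = D.edgeLine x z h) ∧
      ∀ h ∈ Set.Icc (D.pos u).2 (D.pos z).2, ∃ d e, Step (Set.Ici u) d e ∧ u ≤ d ∧ e ≤ z ∧
        (f h, h) ∈ segment ℝ (D.pos d) (D.pos e) := fun x hx hux =>
    D.exists_continuous_path (reflTransGen_step_of_le hux fun t ht => ht.1)
      ⟨hux, hux.trans hx.le, hx⟩
  obtain ⟨f, hf, hfu, hfa, hfm⟩ := path a ha inf_le_left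
  obtain ⟨g, hg, hgu, hgb, hgm⟩ := path b hb inf_le_right
  -- Starting the path at `u ⊓ m` ensures that it is present at every height from `u` up to `z`.
  obtain ⟨k, hk, -, hkm, hkp⟩ := D.exists_continuous_path (C := {v | v ≤ m ∨ v = z})
    (reflTransGen_step_of_le (inf_le_right : u ⊓ m ≤ m) fun t ht => Or.inl ht.2)
    ⟨Or.inl le_rfl, Or.inr rfl, hm⟩
  have avoid : ∀ f : ℝ → ℝ, (∀ h ∈ Set.Icc (D.pos u).2 (D.pos z).2, ∃ d e,
      Step (Set.Ici u) d e ∧ u ≤ d ∧ e ≤ z ∧ (f h, h) ∈ segment ℝ (D.pos d) (D.pos e)) →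
      ∀ h ∈ Set.Ico (D.pos u).2 (D.pos z).2, f h ≠ k h := by
    intro f hfm h hh hfk
    obtain ⟨d, e, hde, hud, hez, hp⟩ := hfm h ⟨hh.1, hh.2.le⟩
    obtain ⟨d', e', hde', -, -, hp'⟩ := hkp h
      ⟨(D.height_le inf_le_left).trans hh.1, hh.2.le⟩
    rw [hfk] at hp
    rcases D.eq_or_exists_common_vertex hde.2.2 hde'.2.2 hp hp' with ⟨rfl, rfl⟩ | ⟨v, hv, h1, h2⟩
    · exact hum (hud.trans (hde'.1.resolve_right (hde.2.2.lt.trans_le hez).ne))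
    · have hvz : v ≠ z := by
        rintro rfl
        exact hh.2.ne' (congrArg Prod.snd hv)
      have huv : u ≤ v := by
        rcases h1 with rfl | rfl
        · exact hde.1
        · exact hde.2.1
      have hvm : v ≤ m ∨ v = z := by
        rcases h2 with rfl | rfl
        · exact hde'.1
        · exact hde'.2.1
      exact hum (huv.trans (hvm.resolve_right hvz))
  set h₀ := max (D.pos a).2 (max (D.pos m).2 (D.pos b).2) with hh₀
  have hlt : h₀ < (D.pos z).2 :=
    max_lt (D.height_lt ha.lt) (max_lt (D.height_lt hm.lt) (D.height_lt hb.lt))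
  have hua : (D.pos u).2 ≤ h₀ := (D.height_le inf_le_left).trans (le_max_left _ _)
  have hord : Set.OrdConnected (Set.Ico (D.pos u).2 (D.pos z).2) := Set.ordConnected_Ico
  have hu0 : (D.pos u).2 ∈ Set.Ico (D.pos u).2 (D.pos z).2 := ⟨le_rfl, hua.trans_lt hlt⟩
  have e1 : f h₀ = _ := hfa h₀ (le_max_left _ _)
  have e2 : k h₀ = _ := hkm h₀ ((le_max_left _ _).trans (le_max_right _ _))
  have e3 : g h₀ = _ := hgb h₀ ((le_max_right _ _).trans (le_max_right _ _))
  have hpos : 0 < (D.pos z).2 - h₀ := by linarith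
  have l1 : f h₀ - k h₀ < 0 := by
    rw [e1, e2, edgeLine, edgeLine]
    nlinarith
  have l2 : k h₀ - g h₀ < 0 := by
    rw [e2, e3, edgeLine, edgeLine]
    nlinarith
  have r1 := neg_of_ne_zero_of_neg (hf.sub hk) hord
    (fun h hh => sub_ne_zero.2 (avoid f hfm h hh)) ⟨hua, hlt⟩ hu0 l1
  have r2 := neg_of_ne_zero_of_neg (hk.sub hg) hord
    (fun h hh => sub_ne_zero.2 (avoid g hgm h hh).symm) ⟨hua, hlt⟩ hu0 l2
  simp only [Pi.sub_apply] at r1 r2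
  linarith

end PlanarDiagram

/-! ### Maximal chains, regions and 4-cells -/

theorem ncard_eq_four {α : Type*} {a b c d : α} (hab : a ≠ b) (hac : a ≠ c) (had : a ≠ d)
    (hbc : b ≠ c) (hbd : b ≠ d) (hcd : c ≠ d) : ({a, b, c, d} : Set α).ncard = 4 := by
  rw [Set.ncard_insert_of_notMem (by simp [hab, hac, had]),
    Set.ncard_insert_of_notMem (by simp [hbc, hbd]), Set.ncard_pair hcd]

namespace PlanarDiagram

section MaxChain

variable {L : Type*} [Lattice L] {a b : L} {C : Set L}

theorem IsMaxChainIn.mem_of_forall (hC : IsMaxChainIn a b C) {t : L} (ht : t ∈ Set.Icc a b)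
    (hcomp : ∀ x ∈ C, t ≤ x ∨ x ≤ t) : t ∈ C :=
  hC.2 (y := insert t C) ⟨Set.insert_subset ht hC.1.1, hC.1.2.insert fun x hx _ => hcomp x hx⟩
    (Set.subset_insert t C) (Set.mem_insert t C)

theorem IsMaxChainIn.left_mem (hC : IsMaxChainIn a b C) (hab : a ≤ b) : a ∈ C :=
  hC.mem_of_forall ⟨le_rfl, hab⟩ fun _ hx => Or.inl (hC.1.1 hx).1

theorem IsMaxChainIn.right_mem (hC : IsMaxChainIn a b C) (hab : a ≤ b) : b ∈ C :=
  hC.mem_of_forall ⟨hab, le_rfl⟩ fun _ hx => Or.inr (hC.1.1 hx).2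

theorem IsMaxChainIn.exists_step [Finite L] (hC : IsMaxChainIn a b C) (hab : a ≤ b) {x : L}
    (hx : x ∈ C) (hxb : x ≠ b) : ∃ y, Step C x y := by
  have hlt : x < b := (hC.1.1 hx).2.lt_of_ne hxb
  obtain ⟨y, ⟨hyC, hxy⟩, hymin⟩ := (Set.toFinite {y ∈ C | x < y}).exists_minimal
    ⟨b, hC.right_mem hab, hlt⟩
  -- With `y` the next element of `C` after `x`, anything strictly between them would be comparable
  -- with all of `C`, hence in `C` by maximality.
  refine ⟨y, hx, hyC, hxy, fun t hxt hty => ?_⟩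
  have htC : t ∈ C := by
    refine hC.mem_of_forall ⟨(hC.1.1 hx).1.trans hxt.le, hty.le.trans (hC.1.1 hyC).2⟩ ?_
    intro w hw
    rcases hC.1.2.total hw hx with h | h
    · exact Or.inr (h.trans hxt.le)
    · rcases h.eq_or_lt with rfl | h
      · exact Or.inr hxt.le
      · rcases hC.1.2.total hw hyC with h' | h'
        · exact Or.inl (hty.le.trans (hymin ⟨hw, h⟩ h'))
        · exact Or.inl (hty.le.trans h')
  exact hty.not_ge (hymin ⟨htC, hxt⟩ hty.le)

theorem IsMaxChainIn.reflTransGen_step [Finite L] (hC : IsMaxChainIn a b C) (hab : a ≤ b) {x : L}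
    (hx : x ∈ C) : Relation.ReflTransGen (Step C) x b := by
  induction x using WellFoundedGT.induction with
  | ind x ih =>
    by_cases hxb : x = b
    · rw [hxb]
    · obtain ⟨y, hxy⟩ := hC.exists_step hab hx hxb
      exact .head hxy (ih y hxy.2.2.lt hxy.2.1)

theorem isMaxChainIn_triple {x y w : L} (hxy : x ⋖ y) (hyw : y ⋖ w) :
    IsMaxChainIn x w {x, y, w} := by
  have hxw := hxy.le.trans hyw.le
  refine ⟨⟨?_, ?_⟩, ?_⟩
  · rintro t (rfl | rfl | rfl)
    exacts [⟨le_rfl, hxw⟩, ⟨hxy.le, hyw.le⟩, ⟨hxw, le_rfl⟩]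
  · rintro s (rfl | rfl | rfl) t (rfl | rfl | rfl) _ <;>
      simp [hxy.le, hyw.le, hxw]
  · rintro E ⟨hE, hchain⟩ hsub t ht
    rcases hchain.total ht (hsub (show y ∈ ({x, y, w} : Set L) by simp)) with h | h
    · rcases hxy.eq_or_eq (hE ht).1 h with rfl | rfl <;> simp
    · rcases hyw.eq_or_eq h (hE ht).2 with rfl | rfl <;> simp

end MaxChain

variable {L : Type*} [Lattice L] (D : PlanarDiagram L)

/-- The polygonal line of a chain has at most one point at each height. -/
theorem eq_of_mem_segments_of_isChain {C : Set L} (hC : IsChain (· ≤ ·) C) {c d e f : L}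
    (hcd : Step C c d) (hef : Step C e f) {p q : ℝ × ℝ} (hp : p ∈ segment ℝ (D.pos c) (D.pos d))
    (hq : q ∈ segment ℝ (D.pos e) (D.pos f)) (hpq : p.2 = q.2) : p = q := by
  wlog hce : c ≤ e generalizing c d e f p q
  · exact (this hef hcd hq hp hpq.symm ((hC.total hcd.1 hef.1).resolve_left hce)).symm
  rcases hce.eq_or_lt with rfl | hlt
  · have hdf : d = f := by
      rcases hC.total hcd.2.1 hef.2.1 with h | h
      · exact (hef.2.2.eq_or_eq hcd.2.2.le h).resolve_left hcd.2.2.lt.ne'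
      · exact ((hcd.2.2.eq_or_eq hef.2.2.le h).resolve_left hef.2.2.lt.ne').symm
    subst hdf
    ext
    · rw [D.eq_edgeLine_of_mem_segment hcd.2.2.lt hp, D.eq_edgeLine_of_mem_segment hcd.2.2.lt hq,
        hpq]
    · exact hpq
  · have hde : d ≤ e := by
      rcases hC.total hcd.2.1 hef.1 with h | h
      · exact h
      · exact ((hcd.2.2.eq_or_eq hlt.le h).resolve_left hlt.ne').ge
    have h1 := (D.height_mem_of_mem_segment hcd.2.2.le hp).2
    have h2 := (D.height_mem_of_mem_segment hef.2.2.le hq).1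
    have h3 := D.height_le hde
    have hde' : d = e := by
      rcases hde.eq_or_lt with h | h
      · exact h
      · have := D.height_lt h
        linarith
    subst hde'
    have hpd : p.2 = (D.pos d).2 := by linarith
    ext
    · rw [D.eq_edgeLine_of_mem_segment hcd.2.2.lt hp, D.eq_edgeLine_of_mem_segment hef.2.2.lt hq,
        ← hpq, hpd, D.edgeLine_top, D.edgeLine_bot hef.2.2.lt]
    · exact hpq

variable {D}

/-- The graph of the polygonal line of a maximal chain of `[a, b]`. -/
theorem IsMaxChainIn.exists_path [Finite L] {a b : L} {C : Set L} (hC : IsMaxChainIn a b C)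
    (hab : a < b) : ∃ f : ℝ → ℝ, Continuous f ∧
      (∀ h ∈ Set.Icc (D.pos a).2 (D.pos b).2, ∃ d e, Step C d e ∧
        (f h, h) ∈ segment ℝ (D.pos d) (D.pos e)) ∧
      (∀ x ∈ C, f (D.pos x).2 = (D.pos x).1) ∧
      (∀ x ∈ Set.Icc a b, D.RightOfChain C x ↔ f (D.pos x).2 ≤ (D.pos x).1) ∧
      (∀ x ∈ Set.Icc a b, D.LeftOfChain C x ↔ (D.pos x).1 ≤ f (D.pos x).2) := by
  obtain ⟨y, hay, hyb⟩ := (Relation.ReflTransGen.cases_tail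
    (hC.reflTransGen_step hab.le (hC.left_mem hab.le))).resolve_left hab.ne'
  obtain ⟨f, hf, -, -, hfm⟩ := D.exists_continuous_path hay hyb
  have hfm' : ∀ h ∈ Set.Icc (D.pos a).2 (D.pos b).2, ∃ d e, Step C d e ∧
      (f h, h) ∈ segment ℝ (D.pos d) (D.pos e) := fun h hh => by
    obtain ⟨d, e, hde, -, -, hm⟩ := hfm h hh
    exact ⟨d, e, hde, hm⟩
  have hIcc : ∀ x ∈ Set.Icc a b, (D.pos x).2 ∈ Set.Icc (D.pos a).2 (D.pos b).2 :=
    fun x hx => ⟨D.height_le hx.1, D.height_le hx.2⟩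
  have huniq : ∀ x ∈ Set.Icc a b, ∀ u v t, Step C u v → t ∈ segment ℝ (D.pos u) (D.pos v) →
      t.2 = (D.pos x).2 → t.1 = f (D.pos x).2 := by
    intro x hx u v t huv ht htx
    obtain ⟨d, e, hde, hm⟩ := hfm' _ (hIcc x hx)
    rw [D.eq_of_mem_segments_of_isChain hC.1.2 huv hde ht hm htx]
  refine ⟨f, hf, hfm', fun x hx => ?_, fun x hx => ⟨?_, fun h => ?_⟩,
    fun x hx => ⟨?_, fun h => ?_⟩⟩
  · by_cases hxb : x = b
    · subst hxb
      exact (huniq x (hC.1.1 hx) _ _ _ hyb (right_mem_segment ℝ _ _) rfl).symm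
    · obtain ⟨z, hz⟩ := hC.exists_step hab.le hx hxb
      exact (huniq x (hC.1.1 hx) _ _ _ hz (left_mem_segment ℝ _ _) rfl).symm
  · rintro ⟨u, hu, v, hv, huv, t, ht, htx, hle⟩
    rwa [← huniq x hx u v t ⟨hu, hv, huv⟩ ht htx]
  · obtain ⟨d, e, hde, hm⟩ := hfm' _ (hIcc x hx)
    exact ⟨d, hde.1, e, hde.2.1, hde.2.2, _, hm, rfl, h⟩
  · rintro ⟨u, hu, v, hv, huv, t, ht, htx, hle⟩
    rwa [← huniq x hx u v t ⟨hu, hv, huv⟩ ht htx]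
  · obtain ⟨d, e, hde, hm⟩ := hfm' _ (hIcc x hx)
    exact ⟨d, hde.1, e, hde.2.1, hde.2.2, _, hm, rfl, h⟩

/-- Two maximal chains of `[a, b]` that meet only in the end points: the polygonal lines do not
meet strictly between the end points. -/
theorem path_ne_path {a b : L} {C₁ C₂ : Set L} (hcov : ¬ a ⋖ b) (hinter : C₁ ∩ C₂ = {a, b})
    {f g : ℝ → ℝ}
    (hf : ∀ h ∈ Set.Icc (D.pos a).2 (D.pos b).2, ∃ d e, Step C₁ d e ∧
      (f h, h) ∈ segment ℝ (D.pos d) (D.pos e))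
    (hg : ∀ h ∈ Set.Icc (D.pos a).2 (D.pos b).2, ∃ d e, Step C₂ d e ∧
      (g h, h) ∈ segment ℝ (D.pos d) (D.pos e)) (hab : a < b) :
    ∀ h ∈ Set.Ioo (D.pos a).2 (D.pos b).2, f h ≠ g h := by
  intro h hh hfg
  obtain ⟨d, e, hde, hp⟩ := hf h ⟨hh.1.le, hh.2.le⟩
  obtain ⟨d', e', hde', hp'⟩ := hg h ⟨hh.1.le, hh.2.le⟩
  rw [hfg] at hp
  have hends : ∀ v, v ∈ C₁ → v ∈ C₂ → v = a ∨ v = b := fun v h1 h2 => by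
    have : v ∈ C₁ ∩ C₂ := ⟨h1, h2⟩
    rwa [hinter] at this
  rcases D.eq_or_exists_common_vertex hde.2.2 hde'.2.2 hp hp' with ⟨rfl, rfl⟩ | ⟨v, hv, h1, h2⟩
  · have hlt := hde.2.2.lt
    rcases hends d hde.1 hde'.1 with rfl | rfl <;> rcases hends e hde.2.1 hde'.2.1 with rfl | rfl
    · exact hlt.false
    · exact hcov hde.2.2
    · exact hlt.not_gt hab
    · exact hlt.false
  · have hv1 : v ∈ C₁ := by
      rcases h1 with rfl | rfl
      · exact hde.1
      · exact hde.2.1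
    have hv2 : v ∈ C₂ := by
      rcases h2 with rfl | rfl
      · exact hde'.1
      · exact hde'.2.1
    have hvh : (D.pos v).2 = h := congrArg Prod.snd hv
    rcases hends v hv1 hv2 with rfl | rfl
    · exact hh.1.ne hvh
    · exact hh.2.ne' hvh

theorem IsMaxChainIn.exists_inner {a b : L} {C : Set L} (hC : IsMaxChainIn a b C) [Finite L]
    (hab : a < b) (hcov : ¬ a ⋖ b) : ∃ c ∈ C, c ≠ a ∧ c ≠ b := by
  obtain ⟨y, hy⟩ := hC.exists_step hab.le (hC.left_mem hab.le) hab.ne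
  exact ⟨y, hy.2.1, hy.2.2.lt.ne', fun h => hcov (h ▸ hy.2.2)⟩

theorem IsMaxChainIn.mem_Ioo {a b : L} {C : Set L} (hC : IsMaxChainIn a b C) {x : L} (hx : x ∈ C)
    (hxa : x ≠ a) (hxb : x ≠ b) : (D.pos x).2 ∈ Set.Ioo (D.pos a).2 (D.pos b).2 :=
  ⟨D.height_lt ((hC.1.1 hx).1.lt_of_ne hxa.symm), D.height_lt ((hC.1.1 hx).2.lt_of_ne hxb)⟩

/-- A region contains both of its bounding chains. -/
theorem subset_region [Finite L] {a b : L} {C₁ C₂ : Set L} (hab : a < b) (hcov : ¬ a ⋖ b)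
    (h₁ : IsMaxChainIn a b C₁) (h₂ : IsMaxChainIn a b C₂) (hinter : C₁ ∩ C₂ = {a, b})
    (hright : ∀ x ∈ C₂ \ {a, b}, D.RightOfChain C₁ x) :
    C₁ ∪ C₂ ⊆ {x | x ∈ Set.Icc a b ∧ D.RightOfChain C₁ x ∧ D.LeftOfChain C₂ x} := by
  obtain ⟨f, hf, hfm, hfC, hfR, -⟩ := h₁.exists_path (D := D) hab
  obtain ⟨g, hg, hgm, hgC, -, hgL⟩ := h₂.exists_path (D := D) hab
  have hne := path_ne_path hcov hinter hfm hgm hab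
  obtain ⟨c, hc, hca, hcb⟩ := h₂.exists_inner hab hcov
  -- The paths do not meet strictly between the ends, so the order found at one inner vertex of `C₂`
  -- persists at every such height.
  have hlt : ∀ h ∈ Set.Ioo (D.pos a).2 (D.pos b).2, f h - g h < 0 := by
    intro h hh
    refine neg_of_ne_zero_of_neg (hf.sub hg) Set.ordConnected_Ioo
      (fun h hh => sub_ne_zero.2 (hne h hh)) (h₂.mem_Ioo hc hca hcb) hh ?_
    have h1 := (hfR c (h₂.1.1 hc)).1 (hright c ⟨hc, by simp [hca, hcb]⟩)
    have h2 := hne _ (h₂.mem_Ioo hc hca hcb)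
    simp only [Pi.sub_apply]
    rw [hgC c hc] at h2 ⊢
    exact sub_neg.2 (h1.lt_of_ne h2)
  have hends : ∀ v, v = a ∨ v = b → v ∈ C₁ ∧ v ∈ C₂ := fun v hv => by
    have : v ∈ C₁ ∩ C₂ := by rw [hinter]; exact hv
    exact this
  rintro x (hx | hx)
  · refine ⟨h₁.1.1 hx, (hfR x (h₁.1.1 hx)).2 (hfC x hx).le, (hgL x (h₁.1.1 hx)).2 ?_⟩
    by_cases hxab : x = a ∨ x = b
    · exact (hgC x (hends x hxab).2).ge
    · push Not at hxab
      have := hlt _ (h₁.mem_Ioo hx hxab.1 hxab.2)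
      rw [hfC x hx] at this
      linarith
  · refine ⟨h₂.1.1 hx, ?_, (hgL x (h₂.1.1 hx)).2 (hgC x hx).ge⟩
    by_cases hxab : x = a ∨ x = b
    · exact (hfR x (h₂.1.1 hx)).2 (hfC x (hends x hxab).1).le
    · push Not at hxab
      exact hright x ⟨hx, by simp [hxab.1, hxab.2]⟩

/-- A region contains its bounding chains, hence at least four elements: its end points and an
inner element of each of the chains. -/
theorem IsRegion.exists_four [Finite L] {R : Set L} (hR : D.IsRegion R) :
    ∃ (a b : L) (C₁ C₂ : Set L) (c d : L), a < b ∧ ¬ a ⋖ b ∧ IsMaxChainIn a b C₁ ∧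
      IsMaxChainIn a b C₂ ∧ C₁ ⊆ R ∧ C₂ ⊆ R ∧ c ∈ C₁ ∧ d ∈ C₂ ∧ c ∉ C₂ ∧ d ∉ C₁ ∧
      ({a, b, c, d} : Set L) ⊆ R ∧ ({a, b, c, d} : Set L).ncard = 4 := by
  obtain ⟨a, b, C₁, C₂, hab, hcov, h₁, h₂, hinter, hright, rfl⟩ := hR
  have hsub := subset_region hab hcov h₁ h₂ hinter hright
  obtain ⟨c, hc, hca, hcb⟩ := h₁.exists_inner hab hcov
  obtain ⟨d, hd, hda, hdb⟩ := h₂.exists_inner hab hcov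
  have hends : ∀ v, v ∈ C₁ → v ∈ C₂ → v = a ∨ v = b := fun v h1 h2 => by
    have : v ∈ C₁ ∩ C₂ := ⟨h1, h2⟩
    rwa [hinter] at this
  have hc2 : c ∉ C₂ := fun h => (hends c hc h).elim hca hcb
  have hd1 : d ∉ C₁ := fun h => (hends d h hd).elim hda hdb
  refine ⟨a, b, C₁, C₂, c, d, hab, hcov, h₁, h₂, Set.subset_union_left.trans hsub,
    Set.subset_union_right.trans hsub, hc, hd, hc2, hd1, ?_, ?_⟩
  · rintro t (rfl | rfl | rfl | rfl)
    · exact hsub (Or.inl (h₁.left_mem hab.le))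
    · exact hsub (Or.inl (h₁.right_mem hab.le))
    · exact hsub (Or.inl hc)
    · exact hsub (Or.inr hd)
  · have hcd : c ≠ d := by rintro rfl; exact hc2 hd
    refine ncard_eq_four hab.ne ?_ ?_ ?_ ?_ hcd
    exacts [hca.symm, hda.symm, hcb.symm, hdb.symm]

/-- Two covers of `x` with a common cover `w` bound a 4-cell, if there are no further elements
in `[x, w]`. -/
theorem isFourCell_of_Icc_eq [Finite L] {x y z w : L} (hxy : x ⋖ y) (hxz : x ⋖ z) (hyw : y ⋖ w)
    (hzw : z ⋖ w) (hyz : y ≠ z) (hIcc : Set.Icc x w ⊆ {x, y, z, w}) :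
    D.IsFourCell {x, y, z, w} := by
  have hxw : x < w := hxy.lt.trans hyw.lt
  have hcov : ¬ x ⋖ w := fun h => h.2 hxy.lt hyw.lt
  have hcard : ({x, y, z, w} : Set L).ncard = 4 :=
    ncard_eq_four hxy.lt.ne hxz.lt.ne hxw.ne hyz hyw.lt.ne hzw.lt.ne
  have hregion : D.IsRegion {x, y, z, w} := by
    have key : ∀ y z, x ⋖ y → x ⋖ z → y ⋖ w → z ⋖ w → y ≠ z → Set.Icc x w ⊆ {x, y, z, w} →
        D.RightOfChain {x, y, w} z → D.IsRegion {x, y, z, w} := by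
      intro y z hxy hxz hyw hzw hyz hIcc hr
      have hinter : ({x, y, w} : Set L) ∩ {x, z, w} = {x, w} := by
        ext t
        simp only [Set.mem_inter_iff, Set.mem_insert_iff, Set.mem_singleton_iff]
        constructor
        · rintro ⟨rfl | rfl | rfl, h | h | h⟩ <;> simp_all
        · rintro (rfl | rfl) <;> simp
      have hright : ∀ t ∈ ({x, z, w} : Set L) \ {x, w}, D.RightOfChain {x, y, w} t := by
        rintro t ⟨rfl | rfl | rfl, ht⟩
        · simp at ht
        · exact hr
        · simp at ht
      refine ⟨x, w, {x, y, w}, {x, z, w}, hxw, hcov, isMaxChainIn_triple hxy hyw,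
        isMaxChainIn_triple hxz hzw, hinter, hright, Set.Subset.antisymm ?_ fun t ht => hIcc ht.1⟩
      refine Set.Subset.trans ?_ (subset_region hxw hcov (isMaxChainIn_triple hxy hyw)
        (isMaxChainIn_triple hxz hzw) hinter hright)
      rintro t (rfl | rfl | rfl | rfl) <;> simp
    have hy : y ∈ ({x, y, w} : Set L) := by simp
    have hz : z ∈ ({x, z, w} : Set L) := by simp
    have m₁ := isMaxChainIn_triple hxy hyw
    have m₂ := isMaxChainIn_triple hxz hzw
    obtain ⟨f, hf, hfm, hfC, hfR, -⟩ := m₁.exists_path (D := D) hxw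
    obtain ⟨g, hg, hgm, hgC, hgR, -⟩ := m₂.exists_path (D := D) hxw
    -- If `z` is not to the right of the chain through `y`, then, since the paths do not cross, `y`
    -- is to the right of the chain through `z`, and the roles are exchanged.
    by_cases hr : D.RightOfChain {x, y, w} z
    · exact key y z hxy hxz hyw hzw hyz hIcc hr
    · have hinter : ({x, y, w} : Set L) ∩ {x, z, w} = {x, w} := by
        ext t
        simp only [Set.mem_inter_iff, Set.mem_insert_iff, Set.mem_singleton_iff]
        constructor
        · rintro ⟨rfl | rfl | rfl, h | h | h⟩ <;> simp_all
        · rintro (rfl | rfl) <;> simp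
      have hne := path_ne_path hcov hinter hfm hgm hxw
      rw [hfR z (m₂.1.1 hz), not_le, ← hgC z hz] at hr
      have hlt := neg_of_ne_zero_of_neg (hg.sub hf) Set.ordConnected_Ioo
        (fun h hh => sub_ne_zero.2 (hne h hh).symm) (m₂.mem_Ioo hz hxz.lt.ne' hzw.lt.ne)
        (m₁.mem_Ioo hy hxy.lt.ne' hyw.lt.ne) (sub_neg.2 hr)
      simp only [Pi.sub_apply, sub_neg, hfC y hy] at hlt
      have hswap : ({x, y, z, w} : Set L) = {x, z, y, w} := by
        rw [Set.insert_comm y z]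
      rw [hswap] at hIcc ⊢
      exact key z y hxz hxy hzw hyw hyz.symm hIcc ((hgR y (m₁.1.1 hy)).2 hlt.le)
  refine ⟨⟨hregion, fun R hR hRS => ?_⟩, hcard⟩
  -- Minimality is a count: every region has at least four elements.
  obtain ⟨a, b, C₁, C₂, c, d, -, -, -, -, -, -, -, -, -, -, hsub, h4⟩ := hR.exists_four
  have := Set.ncard_le_ncard hsub (Set.toFinite R)
  exact (Set.eq_of_subset_of_ncard_le hRS (by omega) (Set.toFinite _)).ge

end PlanarDiagram

/-! ### Swing-closed sets of edges and their congruences -/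

/-- There is a covering chain from `x` up to `y` all of whose edges belong to `E`. -/
def EdgePath {L : Type*} [Lattice L] (E : L → L → Prop) : L → L → Prop :=
  Relation.ReflTransGen fun u v => u ⋖ v ∧ E u v

/-- Closure conditions for a set `E` of edges at the lower covers of an element `z`, which are
listed by the function `σ`. -/
structure IsSwingClosedAt {L : Type*} [Lattice L] (E : L → L → Prop) (z : L) (σ : L → ℝ) :
    Prop where
  inj : ∀ ⦃x y⦄, x ⋖ z → y ⋖ z → σ x = σ y → x = y
  between : ∀ ⦃a m b⦄, a ⋖ z → m ⋖ z → b ⋖ z → σ a < σ m → σ m < σ b → a ⊓ b ≤ m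
  cell : ∀ ⦃x y⦄, x ⋖ z → y ⋖ z → x ≠ y →
    (∀ t, t ⋖ z → ¬ (σ x < σ t ∧ σ t < σ y) ∧ ¬ (σ y < σ t ∧ σ t < σ x)) → E x z →
    x ⊓ y ⋖ y ∧ E (x ⊓ y) y
  swing : ∀ ⦃x y⦄, x ⋖ z → y ⋖ z → x ≠ y →
    (∀ t, t ⋖ z → ¬ (σ x < σ t ∧ σ t < σ y) ∧ ¬ (σ y < σ t ∧ σ t < σ x)) → E x z →
    (∃ a b, a ⋖ z ∧ b ⋖ z ∧ σ a < σ y ∧ σ y < σ b) → E y z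

/-- Closure conditions which make a set `E` of edges the set of edges collapsed by a
congruence. -/
structure IsSwingClosed {L : Type*} [Lattice L] (E : L → L → Prop) : Prop where
  sup : ∀ ⦃x y z⦄, x ⋖ y → x ⋖ z → y ≠ z → E x y → E z (y ⊔ z)
  inf : ∀ z, ∃ σ : L → ℝ, IsSwingClosedAt E z σ

section

variable {L : Type*} [Lattice L]

theorem inf_eq_of_covBy {x y z : L} (hxy : x ⋖ y) (hxz : x ⋖ z) (hyz : y ≠ z) : y ⊓ z = x := by
  rcases hxy.eq_or_eq (le_inf hxy.le hxz.le) inf_le_left with h | h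
  · exact h
  · exact absurd ((hxz.eq_or_eq hxy.le (inf_eq_left.1 h)).resolve_left hxy.lt.ne') hyz

theorem sup_eq_of_covBy {x y z : L} (hxz : x ⋖ z) (hyz : y ⋖ z) (hxy : x ≠ y) : x ⊔ y = z := by
  rcases hxz.eq_or_eq le_sup_left (sup_le hxz.le hyz.le) with h | h
  · exact absurd ((hyz.eq_or_eq (sup_eq_left.1 h) hxz.le).resolve_right hxz.lt.ne) hxy
  · exact h

theorem covBy_sup_of_covBy [IsUpperModularLattice L] {x y z : L} (hxy : x ⋖ y) (hxz : x ⋖ z)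
    (hyz : y ≠ z) : z ⋖ y ⊔ z :=
  IsUpperModularLattice.covBy_sup_of_inf_covBy (by rwa [inf_eq_of_covBy hxy hxz hyz])

/-- The closure conditions are invariant under left-right reflection, so only movement to the right
along the lower covers has to be treated. -/
theorem IsSwingClosedAt.neg {E : L → L → Prop} {z : L} {σ : L → ℝ} (h : IsSwingClosedAt E z σ) :
    IsSwingClosedAt E z (-σ) where
  inj x y hx hy hxy := h.inj hx hy (neg_injective hxy)
  between a m b ha hm hb h1 h2 := by
    rw [inf_comm]
    exact h.between hb hm ha (neg_lt_neg_iff.1 h2) (neg_lt_neg_iff.1 h1)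
  cell x y hx hy hxy hadj := by
    refine h.cell hx hy hxy fun t ht => ?_
    have := hadj t ht
    simp only [Pi.neg_apply, neg_lt_neg_iff] at this
    tauto
  swing x y hx hy hxy hadj hE hint := by
    refine h.swing hx hy hxy (fun t ht => ?_) hE ?_
    · have := hadj t ht
      simp only [Pi.neg_apply, neg_lt_neg_iff] at this
      tauto
    · obtain ⟨a, b, ha, hb, h1, h2⟩ := hint
      exact ⟨b, a, hb, ha, neg_lt_neg_iff.1 h2, neg_lt_neg_iff.1 h1⟩

theorem EdgePath.le {E : L → L → Prop} {x y : L} (h : EdgePath E x y) : x ≤ y := by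
  induction h with
  | refl => exact le_rfl
  | tail _ h ih => exact ih.trans h.1.le

theorem EdgePath.of_edge {E : L → L → Prop} {x y : L} (hxy : x ⋖ y) (h : E x y) :
    EdgePath E x y := .single ⟨hxy, h⟩

theorem EdgePath.edge {E : L → L → Prop} {x y : L} (h : EdgePath E x y) (hxy : x ⋖ y) :
    E x y := by
  rcases Relation.ReflTransGen.cases_head h with rfl | ⟨w, hxw, hwy⟩
  · exact (hxy.lt.false).elim
  · rcases hxy.eq_or_eq hxw.1.le (EdgePath.le hwy) with rfl | rfl
    · exact (hxw.1.lt.false).elim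
    · exact hxw.2

variable [Finite L] {E : L → L → Prop}

namespace IsSwingClosed

/-- The edge is pushed up along a covering chain from `x` to `t`. At each cover `w` it passes to the
opposite edge of the cell spanned by `y` and `w`, unless `y = w`, when `y ≤ t` and nothing is left
to show. -/
theorem edgePath_sup_of_edge [IsUpperModularLattice L] (hE : IsSwingClosed E) {x y t : L}
    (hxy : x ⋖ y) (h : E x y) (hxt : x ≤ t) : EdgePath E t (y ⊔ t) := by
  induction x using WellFoundedGT.induction generalizing y with
  | ind x ih =>
    rcases hxt.eq_or_lt with rfl | hlt
    · rw [sup_eq_left.2 hxy.le]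
      exact .of_edge hxy h
    · obtain ⟨w, hxw, hwt⟩ := exists_covBy_le_of_lt hlt
      by_cases hyw : y = w
      · rw [sup_eq_right.2 (hyw ▸ hwt)]
        exact .refl
      · have := ih w hxw.lt (covBy_sup_of_covBy hxy hxw hyw) (hE.sup hxy hxw hyw h) hwt
        rwa [sup_assoc, sup_eq_right.2 hwt] at this

theorem edgePath_sup [IsUpperModularLattice L] (hE : IsSwingClosed E) {x y : L}
    (h : EdgePath E x y) (t : L) : EdgePath E (x ⊔ t) (y ⊔ t) := by
  induction h with
  | refl => exact .refl
  | @tail b c _ hbc ih =>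
    have := hE.edgePath_sup_of_edge hbc.1 hbc.2 (le_sup_left : b ≤ b ⊔ t)
    rw [← sup_assoc, sup_eq_left.2 hbc.1.le] at this
    exact ih.trans this

end IsSwingClosed

/-- Between lower covers `x` and `y`, there is one next to `y`. -/
theorem exists_adjacent {z x y : L} {σ : L → ℝ} (hx : x ⋖ z) (hxy : σ x < σ y) :
    ∃ w, w ⋖ z ∧ σ x ≤ σ w ∧ σ w < σ y ∧
      ∀ t, t ⋖ z → ¬ (σ w < σ t ∧ σ t < σ y) ∧ ¬ (σ y < σ t ∧ σ t < σ w) := by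
  obtain ⟨w, ⟨hw, hxw, hwy⟩, hmax⟩ := Set.exists_max_image {w | w ⋖ z ∧ σ x ≤ σ w ∧ σ w < σ y} σ
    (Set.toFinite _) ⟨x, hx, le_rfl, hxy⟩
  refine ⟨w, hw, hxw, hwy, fun t ht => ⟨fun h => ?_, fun h => ?_⟩⟩
  · exact h.1.not_ge (hmax t ⟨ht, hxw.trans h.1.le, h.2⟩)
  · exact (h.1.trans h.2).not_gt hwy

/-- Repeated swings, each from the left neighbour. The lower cover `b` ensures that `y` is not the
rightmost one, so that swinging onto it is allowed. -/
theorem IsSwingClosedAt.edge_of_lt {z : L} {σ : L → ℝ} (h : IsSwingClosedAt E z σ) {x : L}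
    (hx : x ⋖ z) (hxz : E x z) {y b : L} (hy : y ⋖ z) (hb : b ⋖ z) (hxy : σ x < σ y)
    (hyb : σ y < σ b) : E y z := by
  have hwf : WellFounded fun a b : L => σ a < σ b :=
    @Finite.wellFounded_of_trans_of_irrefl L _ _ ⟨fun _ _ _ => lt_trans⟩ ⟨fun _ => lt_irrefl _⟩
  induction y using hwf.induction generalizing b with
  | _ y ih =>
    obtain ⟨w, hw, hxw, hwy, hadj⟩ := exists_adjacent (z := z) hx hxy
    have hwz : E w z := by
      rcases hxw.eq_or_lt with heq | hlt
      · exact h.inj hx hw heq ▸ hxz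
      · exact ih w hwy hw hy hlt hwy
    exact h.swing hw hy (by rintro rfl; exact hwy.false) hadj hwz ⟨x, b, hx, hb, hxy, hyb⟩

/-- Induction from left to right. For the left neighbour `w` of `y`, the path from `x ⊓ w` to `w` is
met with `y`; betweenness gives `x ⊓ y ≤ w`, so the result runs from `x ⊓ y` to `w ⊓ y`. The cell of
`w` and `y` supplies the last edge. The hypothesis `hinf` is the induction hypothesis of
`edgePath_inf`. -/
theorem IsSwingClosedAt.edgePath_inf_of_lt {z : L} {σ : L → ℝ} (h : IsSwingClosedAt E z σ)
    (hinf : ∀ w < z, ∀ x t, EdgePath E x w → EdgePath E (x ⊓ t) (w ⊓ t)) {x : L}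
    (hx : x ⋖ z) (hxz : E x z) {y : L} (hy : y ⋖ z) (hxy : σ x < σ y) :
    EdgePath E (x ⊓ y) y := by
  have hwf : WellFounded fun a b : L => σ a < σ b :=
    @Finite.wellFounded_of_trans_of_irrefl L _ _ ⟨fun _ _ _ => lt_trans⟩ ⟨fun _ => lt_irrefl _⟩
  induction y using hwf.induction with
  | _ y ih =>
    obtain ⟨w, hw, hxw, hwy, hadj⟩ := exists_adjacent (z := z) hx hxy
    have hne : w ≠ y := by rintro rfl; exact hwy.false
    rcases hxw.eq_or_lt with heq | hlt
    · obtain rfl := h.inj hx hw heq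
      obtain ⟨hcov, hE⟩ := h.cell hx hy hne hadj hxz
      exact .of_edge hcov hE
    · obtain ⟨hcov, hE⟩ := h.cell hw hy hne hadj (h.edge_of_lt hx hxz hw hy hlt hwy)
      have hp := hinf w hw.lt _ y (ih w hwy hw hlt)
      have heq : x ⊓ w ⊓ y = x ⊓ y := by
        rw [inf_right_comm, inf_eq_left]
        exact h.between hx hw hy hlt hwy
      rw [heq] at hp
      exact hp.trans (EdgePath.of_edge hcov hE)

namespace IsSwingClosed

theorem edgePath_inf (hE : IsSwingClosed E) {x y : L} (h : EdgePath E x y) (t : L) :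
    EdgePath E (x ⊓ t) (y ⊓ t) := by
  induction y using WellFoundedLT.induction generalizing x t with
  | ind y ih =>
    rcases Relation.ReflTransGen.cases_tail h with rfl | ⟨b, hxb, hby, hEb⟩
    · exact .refl
    by_cases hyt : y ≤ t
    · rwa [inf_eq_left.2 hyt, inf_eq_left.2 (h.le.trans hyt)]
    -- Replacing `y` by a lower cover `w` above `y ⊓ t` does not change the meet with `t`. It then
    -- suffices to have a path from `b ⊓ w` to `w`, since `w` is below `y` and the induction
    -- hypothesis applies to it.
    obtain ⟨w, htw, hwy⟩ := exists_le_covBy_of_lt (inf_le_left.lt_of_ne (mt inf_eq_left.1 hyt))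
    have hwt : w ⊓ t = y ⊓ t :=
      le_antisymm (inf_le_inf_right _ hwy.le) (le_inf htw inf_le_right)
    by_cases hbw : b = w
    · subst hbw
      rw [← hwt]
      exact ih b hby.lt hxb t
    · have hinf : EdgePath E (b ⊓ w) w := by
        obtain ⟨σ, hσ⟩ := hE.inf y
        have hlow : ∀ v < y, ∀ x t, EdgePath E x v → EdgePath E (x ⊓ t) (v ⊓ t) :=
          fun v hv x t hxv => ih v hv hxv t
        rcases lt_trichotomy (σ b) (σ w) with hlt | heq | hlt
        · exact hσ.edgePath_inf_of_lt hlow hby hEb hwy hlt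
        · exact (hbw (hσ.inj hby hwy heq)).elim
        · exact hσ.neg.edgePath_inf_of_lt hlow hby hEb hwy (neg_lt_neg hlt)
      have h1 := ih w hwy.lt hinf t
      have heq : b ⊓ w ⊓ t = b ⊓ t := by
        rw [inf_assoc, hwt, ← inf_assoc, inf_eq_left.2 hby.le]
      rw [heq, hwt] at h1
      exact (ih b hby.lt hxb t).trans h1

/-- The congruence whose collapsed edges are the members of a swing-closed set of edges. -/
def latticeCon [IsUpperModularLattice L] (hE : IsSwingClosed E) : LatticeCon L :=
  @LatticeCon.mk' L _ (fun x y => EdgePath E (x ⊓ y) (x ⊔ y))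
    ⟨fun x => by rw [inf_idem, sup_idem]; exact .refl⟩
    (fun x y => by
      rw [inf_eq_left.2 (inf_le_sup : x ⊓ y ≤ x ⊔ y), sup_eq_right.2 (inf_le_sup : x ⊓ y ≤ x ⊔ y)])
    (fun x y z hxy hyz h1 h2 => by
      rw [inf_eq_left.2 hxy, sup_eq_right.2 hxy] at h1
      rw [inf_eq_left.2 hyz, sup_eq_right.2 hyz] at h2
      rw [inf_eq_left.2 (hxy.trans hyz), sup_eq_right.2 (hxy.trans hyz)]
      exact h1.trans h2)
    (fun x y t hxy h => by
      rw [inf_eq_left.2 hxy, sup_eq_right.2 hxy] at h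
      rw [inf_eq_left.2 (inf_le_inf_right t hxy), sup_eq_right.2 (inf_le_inf_right t hxy),
        inf_eq_left.2 (sup_le_sup_right hxy t), sup_eq_right.2 (sup_le_sup_right hxy t)]
      exact ⟨hE.edgePath_inf h t, hE.edgePath_sup h t⟩)

/-- A swing-closed set of edges that contains an edge contains all edges collapsed with it. -/
theorem edge_of_con [IsUpperModularLattice L] (hE : IsSwingClosed E) {x y u v : L} (hxy : x ⋖ y)
    (h : E x y) (huv : u ⋖ v) (hcon : (con x y).r u v) : E u v := by
  have h1 : EdgePath E (u ⊓ v) (u ⊔ v) := hcon hE.latticeCon (by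
    change EdgePath E (x ⊓ y) (x ⊔ y)
    rw [inf_eq_left.2 hxy.le, sup_eq_right.2 hxy.le]
    exact .of_edge hxy h)
  rw [inf_eq_left.2 huv.le, sup_eq_right.2 huv.le] at h1
  exact h1.edge huv

end IsSwingClosed

end

/-! ### Covers in slim and in semimodular lattices -/

section

variable {L : Type*} [Lattice L] [Finite L]

/-- An element of a finite slim lattice has at most two upper covers. -/
theorem IsSlim.eq_of_covBy (hslim : IsSlim L) {x y z t : L} (hy : x ⋖ y) (hz : x ⋖ z)
    (ht : x ⋖ t) (hyz : y ≠ z) : t = y ∨ t = z := by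
  -- Each cover of `x` is the join of `x` with a join-irreducible; those of distinct covers are
  -- incomparable, so three covers would produce a three-element antichain.
  have irr : ∀ w, x ⋖ w → ∃ j, SupIrred j ∧ j ≤ w ∧ x ⊔ j = w := fun w hw => by
    obtain ⟨j, hj, hjw, hjx⟩ := exists_supIrred_le_not_le hw.lt.not_ge
    exact ⟨j, hj, hjw, (hw.eq_or_eq le_sup_left (sup_le hw.le hjw)).resolve_left
      fun h => hjx (sup_eq_left.1 h)⟩
  have incomp : ∀ v w j k, x ⋖ v → x ⋖ w → x ⊔ j = v → x ⊔ k = w → v ≠ w → ¬ j ≤ k := by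
    rintro v w j k hv hw rfl rfl hne hjk
    exact hne ((hw.eq_or_eq hv.le (sup_le_sup_left hjk x)).resolve_left hv.lt.ne')
  by_contra! hne
  obtain ⟨j, hj, -, hjy⟩ := irr y hy
  obtain ⟨k, hk, -, hkz⟩ := irr z hz
  obtain ⟨l, hl, -, hlt⟩ := irr t ht
  exact hslim.false_of_incomparable hj hk hl (incomp y z j k hy hz hjy hkz hyz)
    (incomp z y k j hz hy hkz hjy hyz.symm) (incomp z t k l hz ht hkz hlt hne.2.symm)
    (incomp t z l k ht hz hlt hkz hne.2) (incomp y t j l hy ht hjy hlt hne.1.symm)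
    (incomp t y l j ht hy hlt hjy hne.1)

theorem IsSlim.Icc_subset (hslim : IsSlim L) {x y z w : L} (hxy : x ⋖ y) (hxz : x ⋖ z)
    (hyw : y ⋖ w) (hzw : z ⋖ w) (hyz : y ≠ z) : Set.Icc x w ⊆ {x, y, z, w} := by
  rintro t ⟨hxt, htw⟩
  rcases hxt.eq_or_lt with rfl | hlt
  · simp
  · obtain ⟨v, hxv, hvt⟩ := exists_covBy_le_of_lt hlt
    rcases hslim.eq_of_covBy hxy hxz hxv hyz with rfl | rfl
    · rcases hyw.eq_or_eq hvt htw with rfl | rfl <;> simp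
    · rcases hzw.eq_or_eq hvt htw with rfl | rfl <;> simp

variable [IsUpperModularLattice L] (D : PlanarDiagram L)

/-- Neighbouring lower covers of `z` cover their meet. -/
theorem PlanarDiagram.inf_covBy_of_adjacent {x y z : L} (hx : x ⋖ z) (hy : y ⋖ z)
    (hxy : D.descentSlope z x < D.descentSlope z y)
    (hadj : ∀ t, t ⋖ z → ¬ (D.descentSlope z x < D.descentSlope z t ∧
      D.descentSlope z t < D.descentSlope z y)) : x ⊓ y ⋖ x ∧ x ⊓ y ⋖ y := by
  have hne : x ≠ y := by rintro rfl; exact hxy.false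
  have hux : x ⊓ y < x := inf_le_left.lt_of_ne fun h =>
    hne ((hx.eq_or_eq (inf_eq_left.1 h) hy.le).resolve_right hy.lt.ne).symm
  have huy : x ⊓ y < y := inf_le_right.lt_of_ne fun h =>
    hne ((hy.eq_or_eq (inf_eq_right.1 h) hx.le).resolve_right hx.lt.ne)
  obtain ⟨x', hx', hx'x⟩ := exists_covBy_le_of_lt hux
  obtain ⟨y', hy', hy'y⟩ := exists_covBy_le_of_lt huy
  have hx'y : ¬ x' ≤ y := fun h => hx'.lt.not_ge (le_inf hx'x h)
  have hy'x : ¬ y' ≤ x := fun h => hy'.lt.not_ge (le_inf h hy'y)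
  have hne' : x' ≠ y' := by rintro rfl; exact hx'y hy'y
  have hcx := covBy_sup_of_covBy hy' hx' hne'.symm
  have hcy := covBy_sup_of_covBy hx' hy' hne'
  rw [sup_comm] at hcx
  -- By semimodularity `x' ⊔ y'` covers `x'` and `y'`, so once it equals `z` the elements `x'`, `y'`
  -- must be `x`, `y`. Otherwise it lies below a lower cover `t` of `z` other than `x` and `y`.
  -- Adjacency puts `t` outside the gap between them, and betweenness then forces `y' ≤ x` or `x' ≤
  -- y`.
  have hz : x' ⊔ y' = z := by
    by_contra hwz
    obtain ⟨t, hwt, ht⟩ := exists_le_covBy_of_lt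
      ((sup_le (hx'x.trans hx.le) (hy'y.trans hy.le)).lt_of_ne hwz)
    have hx't := le_sup_left.trans hwt
    have hy't := le_sup_right.trans hwt
    have h1 : D.descentSlope z t ≠ D.descentSlope z x := fun h =>
      hy'x (D.descentSlope_injOn ht hx h ▸ hy't)
    have h2 : D.descentSlope z t ≠ D.descentSlope z y := fun h =>
      hx'y (D.descentSlope_injOn ht hy h ▸ hx't)
    rcases h1.lt_or_gt with h | h
    · exact hy'x ((le_inf hy't hy'y).trans (D.inf_le_of_descentSlope_lt ht hx hy h hxy))
    · rcases h2.lt_or_gt with h' | h'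
      · exact hadj t ht ⟨h, h'⟩
      · exact hx'y ((le_inf hx'x hx't).trans (D.inf_le_of_descentSlope_lt hx hy ht hxy h'))
  rw [hz] at hcx hcy
  refine ⟨?_, ?_⟩
  · rwa [← (hcx.eq_or_eq hx'x hx.le).resolve_right hx.lt.ne] at hx'
  · rwa [← (hcy.eq_or_eq hy'y hy.le).resolve_right hy.lt.ne] at hy'

end

/-! ### Edges reachable by SS-sequences -/

namespace PlanarDiagram

variable {L : Type*} [Lattice L] (D : PlanarDiagram L)

/-- `s` is the next member after `r` in some SS-sequence. -/
def SSStep (r s : PrimeInterval L) : Prop :=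
  D.CellPerspective r s ∨ D.Swings r s

theorem exists_isSSSequence_of_reflTransGen {p q : PrimeInterval L}
    (h : Relation.ReflTransGen D.SSStep p q) :
    ∃ (n : ℕ) (r : Fin (n + 1) → PrimeInterval L),
      r 0 = p ∧ r (Fin.last n) = q ∧ D.IsSSSequence r := by
  induction h using Relation.ReflTransGen.head_induction_on with
  | refl => exact ⟨0, fun _ => q, rfl, rfl, fun i => i.elim0⟩
  | @head a b hab _ ih =>
    obtain ⟨n, r, hr0, hrn, hr⟩ := ih
    refine ⟨n + 1, Fin.cons a r, by simp, by rw [← Fin.succ_last, Fin.cons_succ, hrn], ?_⟩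
    intro i
    cases i using Fin.cases with
    | zero =>
      rw [Fin.castSucc_zero, Fin.cons_zero, Fin.cons_succ, hr0]
      exact hab
    | succ i =>
      rw [Fin.castSucc_succ, Fin.cons_succ, Fin.cons_succ]
      exact hr i

/-- The edges that can be reached from `p` by SS-sequences. -/
def Reachable (p : PrimeInterval L) (x y : L) : Prop :=
  ∃ h : x ⋖ y, Relation.ReflTransGen D.SSStep p ⟨x, y, h⟩

/-- The order of the lower covers is the left-to-right order of the diagram. Neighbours `x`, `y`
span the 4-cell with bottom `x ⊓ y` and top `z`, which carries both the perspectivity and the swing.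
-/
theorem isSwingClosedAt_reachable [Finite L] [IsUpperModularLattice L] (hslim : IsSlim L)
    (p : PrimeInterval L) (z : L) :
    IsSwingClosedAt (D.Reachable p) z (D.descentSlope z) := by
  have cell : ∀ x y, x ⋖ z → y ⋖ z → x ≠ y →
      (∀ t, t ⋖ z → ¬ (D.descentSlope z x < D.descentSlope z t ∧
          D.descentSlope z t < D.descentSlope z y) ∧
        ¬ (D.descentSlope z y < D.descentSlope z t ∧
          D.descentSlope z t < D.descentSlope z x)) →
      x ⊓ y ⋖ y ∧ D.IsFourCell {x ⊓ y, x, y, z} := by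
    intro x y hx hy hne hadj
    have hcov : x ⊓ y ⋖ x ∧ x ⊓ y ⋖ y := by
      rcases lt_trichotomy (D.descentSlope z x) (D.descentSlope z y) with h | h | h
      · exact D.inf_covBy_of_adjacent hx hy h fun t ht => (hadj t ht).1
      · exact (hne (D.descentSlope_injOn hx hy h)).elim
      · rw [inf_comm]
        exact (D.inf_covBy_of_adjacent hy hx h fun t ht => (hadj t ht).2).symm
    exact ⟨hcov.2, isFourCell_of_Icc_eq hcov.1 hcov.2 hx hy hne
      (hslim.Icc_subset hcov.1 hcov.2 hx hy hne)⟩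
  refine ⟨fun x y => D.descentSlope_injOn, fun a m b => D.inf_le_of_descentSlope_lt, ?_, ?_⟩
  · rintro x y hx hy hne hadj ⟨_, hE⟩
    obtain ⟨hcov, hcell⟩ := cell x y hx hy hne hadj
    refine ⟨hcov, hcov, hE.tail (Or.inl ⟨_, hcell, ⟨by simp, by simp⟩, ⟨by simp, by simp⟩, ?_⟩)⟩
    rw [Set.disjoint_left]
    rintro t (rfl | rfl) (h | h)
    · exact hne ((hx.eq_or_eq (inf_eq_left.1 h.symm) hy.le).resolve_right hy.lt.ne).symm
    · exact hne h
    · exact (inf_le_left.trans_lt hx.lt).ne' h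
    · exact hy.lt.ne' h
  · rintro x y hx hy hne hadj ⟨_, hE⟩ ⟨a, b, ha, hb, hay, hyb⟩
    obtain ⟨-, hcell⟩ := cell x y hx hy hne hadj
    refine ⟨hy, hE.tail (Or.inr ⟨?_, ⟨_, hcell, ⟨by simp, by simp⟩, ⟨by simp, by simp⟩⟩, rfl, ?_,
      fun h => hay.not_ge (h.2 a ha), fun h => hyb.not_ge (h.2 b hb)⟩)⟩
    · exact fun h => hne (congrArg PrimeInterval.lo h)
    · have hay' : a ≠ y := by rintro rfl; exact hay.false
      have hyb' : y ≠ b := by rintro rfl; exact hyb.false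
      have hab' : a ≠ b := by rintro rfl; exact (hay.trans hyb).false
      have hsub : ({a, y, b} : Set L) ⊆ {t | t ⋖ z} := by
        rintro t (rfl | rfl | rfl) <;> assumption
      rw [← Set.ncard_eq_three.2 ⟨a, y, b, hay', hab', hyb', rfl⟩]
      exact Set.ncard_le_ncard hsub (Set.toFinite _)

theorem isSwingClosed_reachable [Finite L] [IsUpperModularLattice L] (hslim : IsSlim L)
    (p : PrimeInterval L) : IsSwingClosed (D.Reachable p) where
  inf z := ⟨_, D.isSwingClosedAt_reachable hslim p z⟩
  sup := by
    rintro x y z hxy hxz hne ⟨_, hE⟩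
    have hz := covBy_sup_of_covBy hxy hxz hne
    have hy := covBy_sup_of_covBy hxz hxy hne.symm
    rw [sup_comm] at hy
    refine ⟨hz, hE.tail (Or.inl ⟨_, isFourCell_of_Icc_eq hxy hxz hy hz hne
      (hslim.Icc_subset hxy hxz hy hz hne), ⟨by simp, by simp⟩, ⟨by simp, by simp⟩, ?_⟩)⟩
    rw [Set.disjoint_left]
    rintro t (rfl | rfl) (h | h)
    · exact hxz.lt.ne h
    · exact (hxy.lt.trans hy.lt).ne h
    · exact hne h
    · exact hy.lt.ne h

/-! ### Congruences are closed under SS-steps -/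

/-- The four vertices and the four edges of a 4-cell. -/
theorem IsFourCell.exists_eq [Finite L] {D : PlanarDiagram L} {S : Set L} (hS : D.IsFourCell S) :
    ∃ a b c d, S = {a, b, c, d} ∧ a ⋖ c ∧ a ⋖ d ∧ c ⋖ b ∧ d ⋖ b ∧ c ≠ d := by
  obtain ⟨a, b, C₁, C₂, c, d, hab, hcov, h₁, h₂, hC₁, hC₂, hc, hd, hc2, hd1, hsub, h4⟩ :=
    hS.1.1.exists_four
  have hSeq : {a, b, c, d} = S :=
    Set.eq_of_subset_of_ncard_le hsub (by rw [h4, hS.2]) (Set.toFinite _)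
  have inner : ∀ C c d, IsMaxChainIn a b C → C ⊆ {a, b, c, d} → c ∈ C → d ∉ C → c ≠ a → c ≠ b →
      a ⋖ c ∧ c ⋖ b := by
    intro C c d hC hCS hc hd hca hcb
    have mem : ∀ y ∈ C, y = a ∨ y = b ∨ y = c := fun y hy => by
      rcases hCS hy with h | h | h | h
      · exact Or.inl h
      · exact Or.inr (Or.inl h)
      · exact Or.inr (Or.inr h)
      · exact (hd (h ▸ hy)).elim
    obtain ⟨y, hy⟩ := hC.exists_step hab.le (hC.left_mem hab.le) hab.ne
    obtain ⟨w, hw⟩ := hC.exists_step hab.le hc hcb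
    constructor
    · rcases mem y hy.2.1 with rfl | rfl | rfl
      · exact (hy.2.2.lt.false).elim
      · exact (hcov hy.2.2).elim
      · exact hy.2.2
    · rcases mem w hw.2.1 with rfl | rfl | rfl
      · exact ((hC.1.1 hc).1.not_gt hw.2.2.lt).elim
      · exact hw.2.2
      · exact (hw.2.2.lt.false).elim
  obtain ⟨hac, hcb⟩ := inner C₁ c d h₁ (hSeq ▸ hC₁) hc hd1
    (by rintro rfl; exact hc2 (h₂.left_mem hab.le)) (by rintro rfl; exact hc2 (h₂.right_mem hab.le))
  obtain ⟨had, hdb⟩ := inner C₂ d c h₂ (by rw [Set.pair_comm d c, hSeq]; exact hC₂) hd hc2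
    (by rintro rfl; exact hd1 (h₁.left_mem hab.le)) (by rintro rfl; exact hd1 (h₁.right_mem hab.le))
  exact ⟨a, b, c, d, hSeq.symm, hac, had, hcb, hdb, by rintro rfl; exact hc2 hd⟩

theorem con_of_perspective {a b c d : L} (had : a ⋖ d) (hcb : c ⋖ b) (hdb : d ⋖ b)
    (hcd : c ≠ d) (θ : LatticeCon L) (h : θ.r a c) : θ.r d b := by
  have := θ.sup h (θ.refl d)
  rwa [sup_eq_right.2 had.le, sup_eq_of_covBy hcb hdb hcd] at this

theorem con_of_perspective_symm {a b c d : L} (hac : a ⋖ c) (had : a ⋖ d) (hcb : c ⋖ b)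
    (hcd : c ≠ d) (θ : LatticeCon L) (h : θ.r d b) : θ.r a c := by
  have := θ.inf h (θ.refl c)
  rwa [inf_comm d c, inf_eq_of_covBy hac had hcd, inf_eq_right.2 hcb.le] at this

theorem CellPerspective.collapse [Finite L] {D : PlanarDiagram L} {r s : PrimeInterval L}
    (h : D.CellPerspective r s) (θ : LatticeCon L) (hθ : θ.r r.lo r.hi) : θ.r s.lo s.hi := by
  obtain ⟨S, hS, hr, hs, hdisj⟩ := h
  obtain ⟨a, b, c, d, rfl, hac, had, hcb, hdb, hcd⟩ := hS.exists_eq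
  have edge : ∀ r : PrimeInterval L, EdgeOf r ({a, b, c, d} : Set L) →
      (r.lo = a ∧ r.hi = c) ∨ (r.lo = a ∧ r.hi = d) ∨ (r.lo = c ∧ r.hi = b) ∨
        (r.lo = d ∧ r.hi = b) := by
    rintro ⟨x, y, hxy⟩ ⟨hx, hy⟩
    simp only [Set.mem_insert_iff, Set.mem_singleton_iff] at hx hy ⊢
    have hcd' : ¬ c ≤ d := fun h =>
      hcd ((had.eq_or_eq hac.le h).resolve_left hac.lt.ne')
    have hdc' : ¬ d ≤ c := fun h =>
      hcd ((hac.eq_or_eq had.le h).resolve_left had.lt.ne').symm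
    have hab := hac.lt.trans hcb.lt
    rcases hx with rfl | rfl | rfl | rfl <;> rcases hy with rfl | rfl | rfl | rfl
    · exact (hxy.lt.false).elim
    · exact (hxy.2 hac.lt hcb.lt).elim
    · simp
    · simp
    · exact (hxy.lt.not_gt hab).elim
    · exact (hxy.lt.false).elim
    · exact (hxy.lt.not_gt hcb.lt).elim
    · exact (hxy.lt.not_gt hdb.lt).elim
    · exact (hxy.lt.not_gt hac.lt).elim
    · simp
    · exact (hxy.lt.false).elim
    · exact (hcd' hxy.le).elim
    · exact (hxy.lt.not_gt had.lt).elim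
    · simp
    · exact (hdc' hxy.le).elim
    · exact (hxy.lt.false).elim
  have hd := Set.disjoint_left.1 hdisj
  simp only [Set.mem_insert_iff, Set.mem_singleton_iff] at hd
  have h1 := hd (Or.inl rfl)
  have h2 := hd (Or.inr rfl)
  -- Of the sixteen pairs of sides, disjointness leaves the four ordered pairs of opposite ones.
  rcases edge r hr with ⟨e1, e2⟩ | ⟨e1, e2⟩ | ⟨e1, e2⟩ | ⟨e1, e2⟩ <;>
  rcases edge s hs with ⟨e3, e4⟩ | ⟨e3, e4⟩ | ⟨e3, e4⟩ | ⟨e3, e4⟩ <;>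
  rw [e1, e3, e4] at h1 <;> rw [e2, e3, e4] at h2 <;> rw [e1, e2] at hθ <;> rw [e3, e4] <;>
  first
    | exact absurd (Or.inl rfl) h1
    | exact absurd (Or.inr rfl) h1
    | exact absurd (Or.inl rfl) h2
    | exact absurd (Or.inr rfl) h2
    | exact con_of_perspective had hcb hdb hcd θ hθ
    | exact con_of_perspective hac hdb hcb hcd.symm θ hθ
    | exact con_of_perspective_symm hac had hcb hcd θ hθ
    | exact con_of_perspective_symm had hac hdb hcd.symm θ hθ

/-- Since `s.lo` is neither leftmost nor rightmost, some lower cover `t` lies on its far side from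
`r.lo`, and betweenness gives `r.lo ⊓ t ≤ s.lo`. Meeting the collapsed pair with `t` and then
joining with `s.lo` turns it into `s.lo`, `s.hi`. -/
theorem Swings.collapse [Finite L] {D : PlanarDiagram L} {r s : PrimeInterval L}
    (h : D.Swings r s) (θ : LatticeCon L) (hθ : θ.r r.lo r.hi) : θ.r s.lo s.hi := by
  obtain ⟨hne, -, hhi, -, hleft, hright⟩ := h
  have hs : s.lo ⋖ r.hi := hhi ▸ s.covBy
  have hr := r.covBy
  have hlo : r.lo ≠ s.lo := fun h => hne (PrimeInterval.ext h hhi)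
  have key : ∀ t, t ⋖ r.hi → r.lo ⊓ t ≤ s.lo → t ≠ s.lo → θ.r s.lo s.hi := by
    intro t ht hle hts
    have h1 := θ.sup (θ.inf hθ (θ.refl t)) (θ.refl s.lo)
    rwa [sup_eq_right.2 hle, inf_eq_right.2 ht.le, sup_eq_of_covBy ht hs hts, hhi] at h1
  simp only [IsLeftmostLowerCover, IsRightmostLowerCover, not_and, not_forall, not_le]
    at hleft hright
  obtain ⟨a, ha, hal⟩ := hleft hs
  obtain ⟨b, hb, hbr⟩ := hright hs
  rcases lt_trichotomy (D.descentSlope r.hi r.lo) (D.descentSlope r.hi s.lo) with hlt | heq | hlt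
  · exact key b hb (D.inf_le_of_descentSlope_lt hr hs hb hlt hbr) (by rintro rfl; exact hbr.false)
  · exact (hlo (D.descentSlope_injOn hr hs heq)).elim
  · refine key a ha ?_ (by rintro rfl; exact hal.false)
    rw [inf_comm]
    exact D.inf_le_of_descentSlope_lt ha hs hr hal hlt

end PlanarDiagram

end SwingLemma

theorem mainTheorem3 {L : Type*} [Lattice L] [Finite L] [IsUpperModularLattice L]
    (hslim : SwingLemma.IsSlim L) :
    Nonempty (SwingLemma.PlanarDiagram L) ∧
    ∀ (D : SwingLemma.PlanarDiagram L) (p q : SwingLemma.PrimeInterval L),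
      (SwingLemma.con p.lo p.hi).r q.lo q.hi ↔
        ∃ (n : ℕ) (r : Fin (n + 1) → SwingLemma.PrimeInterval L),
          r 0 = p ∧ r (Fin.last n) = q ∧ D.IsSSSequence r := by
  obtain ⟨f, g, hfg⟩ := hslim.exists_dominance
  refine ⟨SwingLemma.nonempty_planarDiagram_of_dominance f g hfg, fun D p q => ⟨fun h => ?_, ?_⟩⟩
  · obtain ⟨_, hq⟩ := (D.isSwingClosed_reachable hslim p).edge_of_con p.covBy
      ⟨p.covBy, .refl⟩ q.covBy h
    exact D.exists_isSSSequence_of_reflTransGen hq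
  · rintro ⟨n, r, rfl, rfl, hr⟩ θ hθ
    have : ∀ i, θ.r (r i).lo (r i).hi := by
      intro i
      induction i using Fin.induction with
      | zero => exact hθ
      | succ i ih => exact (hr i).elim (fun h => h.collapse θ ih) fun h => h.collapse θ ih
    exact this _
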